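/- Let $\mathbb D$ be the open unit disc of $\mathbb C$, $dm$ the normalized Lebesgue area measure on $\mathbb D$, and $\varphi_a(z)=\frac{a-z}{1-\bar a z}$ for $a\in\mathbb D$. For $1\le p<\infty$, $f$ analytic on $\mathbb D$ and $a\in\mathbb D$ put $$I_p(f,a)=\int_{\mathbb D}|f'(z)|^p(1-|z|^2)^{p-2}(1-|\varphi_a(z)|^2)\,dm(z).$$ Let $BMOA_p$ be the space of analytic functions $f$ on $\mathbb D$ with $\sup_{a\in\mathbb D}I_p(f,a)<\infty$, with the norm $\|f\|_{BMOA_p}=\bigl(|f(0)|^p+\sup_{a\in\mathbb D}I_p(f,a)\bigr)^{1/p}$, and let $VMOA_p$ be the space of analytic functions $f$ on $\mathbb D$ with $\lim_{|a|\to1}I_p(f,a)=0$, with the same norm. A semigroup $\{\phi_t\}_{t\ge0}$ is a family of analytic self-maps of $\mathbb D$ such that $\phi_0(z)=z$, $\phi_t\circ\phi_s=\phi_{t+s}$ for all $t,s\ge0$, and $\phi_t\to\phi_0$ uniformly on compact subsets of $\mathbb D$ as $t\to0^+$. Let $[\phi_t,BMOA_p]=\{f\in BMOA_p:\lim_{t\to0^+}\|f\circ\phi_t-f\|_{BMOA_p}=0\}$.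 **Theorem.** Let $\{\phi_t\}_{t\ge 0}$ be a semigroup of analytic self-maps of $\mathbb D$ and let $1\le p<\infty$. Then the induced composition semigroup $T_tf=f\circ\phi_t$ is strongly continuous on $VMOA_p$: each $T_t$, $t\ge0$, maps $VMOA_p$ into itself and is bounded there, $T_0$ is the identity, $T_tT_s=T_{t+s}$ for all $t,s\ge 0$, and $\lim_{t\to0^+}\|T_tf-f\|_{BMOA_p}=0$ for every $f\in VMOA_p$. Consequently $VMOA_p\subseteq[\phi_t,BMOA_p]$. -/

import Mathlib

open MeasureTheory Filter Topology
open scoped ENNReal NNReal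

namespace BMOAp

noncomputable section

/-- The open unit disc of the complex plane. -/
abbrev disc : Set ℂ := Metric.ball 0 1

/-- Normalized Lebesgue area measure `dm = r dr dθ / π` on the unit disc. -/
def area : Measure ℂ := (ENNReal.ofReal Real.pi)⁻¹ • (volume : Measure ℂ).restrict disc

/-- The Möbius automorphism `z ↦ (a - z) / (1 - conj a * z)` of the disc. -/
def mobius (a z : ℂ) : ℂ := (a - z) / (1 - (starRingEnd ℂ) a * z)

/-- The integral `∫_𝔻 |f'(z)|^p (1 - |z|²)^(p-2) (1 - |φ_a(z)|²) dm(z)`, with values in `[0, ∞]`. -/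
def oscInt (p : ℝ) (f : ℂ → ℂ) (a : ℂ) : ℝ≥0∞ :=
  ∫⁻ z, ENNReal.ofReal
    (‖deriv f z‖ ^ p * (1 - ‖z‖ ^ 2) ^ (p - 2) * (1 - ‖mobius a z‖ ^ 2)) ∂area

/-- The norm `(|f(0)|^p + sup_{a ∈ 𝔻} oscInt p f a)^(1/p)`, with value `∞` when the supremum
is infinite. -/
def bmoaNorm (p : ℝ) (f : ℂ → ℂ) : ℝ≥0∞ :=
  (ENNReal.ofReal (‖f 0‖ ^ p) + ⨆ a ∈ disc, oscInt p f a) ^ (1 / p)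

/-- The space `BMOA_p`. Analytic functions on the disc are represented by functions on `ℂ` that are
holomorphic on the disc; their values outside the disc are irrelevant. -/
def BMOA (p : ℝ) : Set (ℂ → ℂ) :=
  {f | DifferentiableOn ℂ f disc ∧ ⨆ a ∈ disc, oscInt p f a < ∞}

/-- The space `VMOA_p`: the integrals tend to `0` as `|a| → 1` within the disc. -/
def VMOA (p : ℝ) : Set (ℂ → ℂ) :=
  {f | DifferentiableOn ℂ f disc ∧
    Tendsto (oscInt p f) (comap (fun a : ℂ => ‖a‖) (𝓝[<] (1 : ℝ))) (𝓝 0)}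

/-- `(φ t)`, `t ≥ 0`, is a semigroup of analytic self-maps of the disc. -/
structure IsSemigroup (φ : ℝ → ℂ → ℂ) : Prop where
  analytic : ∀ t, 0 ≤ t → DifferentiableOn ℂ (φ t) disc
  mapsTo : ∀ t, 0 ≤ t → Set.MapsTo (φ t) disc disc
  zero : ∀ z ∈ disc, φ 0 z = z
  comp : ∀ t s, 0 ≤ t → 0 ≤ s → ∀ z ∈ disc, φ t (φ s z) = φ (t + s) z
  tendsto : ∀ K : Set ℂ, K ⊆ disc → IsCompact K →
    TendstoUniformlyOn φ (fun z => z) (𝓝[>] (0 : ℝ)) K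

/-- The operators `T_t f = f ∘ φ_t` form a strongly continuous semigroup of bounded operators on the
space `X` of analytic functions on the disc, with norm `N`: they map `X` to itself, are bounded,
satisfy the semigroup laws, and `N (T_t f - f) → 0` as `t → 0⁺` for every `f` in `X`. -/
structure IsStronglyContinuousOn (φ : ℝ → ℂ → ℂ) (X : Set (ℂ → ℂ)) (N : (ℂ → ℂ) → ℝ≥0∞) :
    Prop where
  mapsTo : ∀ t, 0 ≤ t → ∀ f ∈ X, f ∘ φ t ∈ X
  bounded : ∀ t, 0 ≤ t → ∃ C : ℝ≥0, ∀ f ∈ X, N (f ∘ φ t) ≤ C * N f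
  zero : ∀ f ∈ X, Set.EqOn (f ∘ φ 0) f disc
  add : ∀ t s, 0 ≤ t → 0 ≤ s → ∀ f ∈ X, Set.EqOn ((f ∘ φ t) ∘ φ s) (f ∘ φ (t + s)) disc
  tendsto : ∀ f ∈ X, Tendsto (fun t => N (f ∘ φ t - f)) (𝓝[>] (0 : ℝ)) (𝓝 0)

/-- The maximal subspace of strong continuity
`[φ_t, X] = {f ∈ X : lim_{t → 0⁺} ‖f ∘ φ_t - f‖ = 0}`. -/
def maximalSubspace (φ : ℝ → ℂ → ℂ) (X : Set (ℂ → ℂ)) (N : (ℂ → ℂ) → ℝ≥0∞) : Set (ℂ → ℂ) :=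
  {f ∈ X | Tendsto (fun t => N (f ∘ φ t - f)) (𝓝[>] (0 : ℝ)) (𝓝 0)}

end

end BMOAp

namespace BMOAp

noncomputable section

/-! Write C for a constant depending only on p. Two facts carry the theorem: every member of a
semigroup is univalent (`IsSemigroup.injOn`), and every univalent self-map φ satisfies I_p(f ∘ φ, a)
≤ C · I_p(f, φ(a)), uniformly in φ and in a (`oscInt_comp_le`). The uniformity in t allows f to be
replaced by a nicer function before t tends to 0.

For the composition bound, conformal invariance (`osc_comp_mobius`) reduces to a = 0 and φ(0) = 0.
The value of |F|^p at φ(z) is dominated by its average over the Whitney disc of φ(z). After Fubini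
it remains to integrate |φ'|^p (1 - |z|²)^(p-1) over the points z whose image has ζ in its Whitney
disc (`lintegral_whitneyPreimage_le`). Univalence bounds the integral of |φ'|² there by an area of
order (1 - |ζ|)², and a Poisson kernel pulled back by φ bounds the area of the set by the same order
(`volume_whitneyPreimage_le`). Hölder's inequality (p ≤ 2) or Schwarz–Pick (p > 2) finishes.

A function of VMOA_p is approximated by its dilations uniformly in a (`eventually_oscInt_dil_le`):
near the boundary both integrals are small by the composition bound, and the remaining a are
compared with a = 0. A dilation g has bounded derivative. For functions with (1 - |z|²)|u| bounded,
I_p is controlled by a Dirichlet integral (`osc_le_dirichlet`). The Dirichlet integral of g ∘ φ_t -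
g tends to 0 because φ_t' tends to 1 in mean square (`lintegral_deriv_sub_one_sq_le`). The triangle
inequality then gives strong continuity, and the same approximation gives invariance of VMOA_p. -/

/-! ### Möbius automorphisms of the disc. -/

theorem norm_lt_one {z : ℂ} (hz : z ∈ disc) : ‖z‖ < 1 := by simpa using hz

theorem one_sub_norm_sq_pos {z : ℂ} (hz : z ∈ disc) : 0 < 1 - ‖z‖ ^ 2 := by
  have := norm_lt_one hz
  nlinarith [norm_nonneg z]

theorem one_sub_norm_le {a z : ℂ} (hz : z ∈ disc) :
    1 - ‖a‖ ≤ ‖1 - (starRingEnd ℂ) a * z‖ := by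
  have h1 : ‖(starRingEnd ℂ) a * z‖ ≤ ‖a‖ := by
    rw [norm_mul, RCLike.norm_conj]
    exact mul_le_of_le_one_right (norm_nonneg _) (norm_lt_one hz).le
  have h2 := norm_sub_norm_le (1 : ℂ) ((starRingEnd ℂ) a * z)
  rw [norm_one] at h2
  linarith

theorem mobius_denom_norm_pos {a z : ℂ} (ha : a ∈ disc) (hz : z ∈ disc) :
    0 < ‖1 - (starRingEnd ℂ) a * z‖ :=
  lt_of_lt_of_le (by have := norm_lt_one ha; linarith) (one_sub_norm_le hz)

theorem mobius_denom_ne_zero {a z : ℂ} (ha : a ∈ disc) (hz : z ∈ disc) :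
    1 - (starRingEnd ℂ) a * z ≠ 0 :=
  norm_pos_iff.1 (mobius_denom_norm_pos ha hz)

theorem normSq_denom_sub (a z : ℂ) :
    ‖1 - (starRingEnd ℂ) a * z‖ ^ 2 - ‖a - z‖ ^ 2 = (1 - ‖a‖ ^ 2) * (1 - ‖z‖ ^ 2) := by
  simp only [Complex.sq_norm, Complex.normSq_apply, Complex.sub_re, Complex.sub_im, Complex.mul_re,
    Complex.mul_im, Complex.conj_re, Complex.conj_im, Complex.one_re, Complex.one_im]
  ring

theorem one_sub_norm_mobius_sq {a z : ℂ} (ha : a ∈ disc) (hz : z ∈ disc) :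
    1 - ‖mobius a z‖ ^ 2 =
      (1 - ‖a‖ ^ 2) * (1 - ‖z‖ ^ 2) / ‖1 - (starRingEnd ℂ) a * z‖ ^ 2 := by
  have h := mobius_denom_norm_pos ha hz
  rw [← normSq_denom_sub, mobius, norm_div, sub_div, div_self (by positivity), div_pow]

theorem one_sub_norm_mobius_sq_pos {a z : ℂ} (ha : a ∈ disc) (hz : z ∈ disc) :
    0 < 1 - ‖mobius a z‖ ^ 2 := by
  rw [one_sub_norm_mobius_sq ha hz]
  have h := mobius_denom_norm_pos ha hz
  have := one_sub_norm_sq_pos ha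
  have := one_sub_norm_sq_pos hz
  positivity

theorem mobius_mem_disc {a z : ℂ} (ha : a ∈ disc) (hz : z ∈ disc) : mobius a z ∈ disc := by
  have h := one_sub_norm_mobius_sq_pos ha hz
  rw [mem_ball_zero_iff]
  nlinarith [norm_nonneg (mobius a z)]

theorem mapsTo_mobius {a : ℂ} (ha : a ∈ disc) : Set.MapsTo (mobius a) disc disc :=
  fun _ hz => mobius_mem_disc ha hz

@[simp] theorem mobius_zero_right (a : ℂ) : mobius a 0 = a := by simp [mobius]

@[simp] theorem mobius_self (a : ℂ) : mobius a a = 0 := by simp [mobius]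

theorem norm_mobius_zero_left (z : ℂ) : ‖mobius 0 z‖ = ‖z‖ := by simp [mobius]

theorem mobius_mobius {a z : ℂ} (ha : a ∈ disc) (hz : z ∈ disc) : mobius a (mobius a z) = z := by
  have h1 := mobius_denom_ne_zero ha hz
  have h3 := mobius_denom_ne_zero ha (mobius_mem_disc ha hz)
  have h4 : mobius a z * (1 - (starRingEnd ℂ) a * z) = a - z := div_mul_cancel₀ _ h1
  rw [mobius, div_eq_iff h3]
  linear_combination -h4

theorem injOn_mobius {a : ℂ} (ha : a ∈ disc) : Set.InjOn (mobius a) disc := fun z hz w hw h => by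
  rw [← mobius_mobius ha hz, h, mobius_mobius ha hw]

theorem hasDerivAt_mobius {a z : ℂ} (ha : a ∈ disc) (hz : z ∈ disc) :
    HasDerivAt (mobius a) (-(1 - ‖a‖ ^ 2 : ℝ) / (1 - (starRingEnd ℂ) a * z) ^ 2) z := by
  have h1 := mobius_denom_ne_zero ha hz
  have := ((hasDerivAt_id z).const_sub a).div
    (((hasDerivAt_id z).const_mul ((starRingEnd ℂ) a)).const_sub 1) h1
  have h2 : (starRingEnd ℂ) a * a = (‖a‖ : ℂ) ^ 2 := Complex.conj_mul' a
  refine this.congr_deriv ?_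
  simp only [id]
  push_cast
  rw [← h2]
  ring

theorem differentiableOn_mobius {a : ℂ} (ha : a ∈ disc) : DifferentiableOn ℂ (mobius a) disc :=
  fun _ hz => (hasDerivAt_mobius ha hz).differentiableAt.differentiableWithinAt

theorem norm_deriv_mobius {a z : ℂ} (ha : a ∈ disc) (hz : z ∈ disc) :
    ‖deriv (mobius a) z‖ = (1 - ‖a‖ ^ 2) / ‖1 - (starRingEnd ℂ) a * z‖ ^ 2 := by
  rw [(hasDerivAt_mobius ha hz).deriv, norm_div, norm_neg, Complex.norm_real, norm_pow,
    Real.norm_of_nonneg (one_sub_norm_sq_pos ha).le]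

/-- Automorphisms attain equality in Schwarz–Pick. The conformal invariance of the integrals rests
on this identity. -/
theorem norm_deriv_mobius_mul {a z : ℂ} (ha : a ∈ disc) (hz : z ∈ disc) :
    ‖deriv (mobius a) z‖ * (1 - ‖z‖ ^ 2) = 1 - ‖mobius a z‖ ^ 2 := by
  rw [norm_deriv_mobius ha hz, one_sub_norm_mobius_sq ha hz]
  ring

theorem isOpen_disc : IsOpen disc := Metric.isOpen_ball

theorem zero_mem_disc : (0 : ℂ) ∈ disc := by simp

theorem differentiableAt_of_disc {f : ℂ → ℂ} (hf : DifferentiableOn ℂ f disc) {z : ℂ}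
    (hz : z ∈ disc) : DifferentiableAt ℂ f z :=
  hf.differentiableAt (isOpen_disc.mem_nhds hz)

theorem deriv_comp_disc {f φ : ℂ → ℂ} (hf : DifferentiableOn ℂ f disc)
    (hφ : DifferentiableOn ℂ φ disc) (hm : Set.MapsTo φ disc disc) {z : ℂ} (hz : z ∈ disc) :
    deriv (f ∘ φ) z = deriv f (φ z) * deriv φ z :=
  deriv_comp z (differentiableAt_of_disc hf (hm hz)) (differentiableAt_of_disc hφ hz)

theorem deriv_congr_disc {f g : ℂ → ℂ} (h : Set.EqOn f g disc) {z : ℂ} (hz : z ∈ disc) :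
    deriv f z = deriv g z :=
  (h.eventuallyEq_of_mem (isOpen_disc.mem_nhds hz)).deriv_eq

/-! ### The Schwarz–Pick inequalities. -/

/-- The conjugate of a self-map of the disc by Möbius maps which sends `0` to `0`. -/
def conjMap (φ : ℂ → ℂ) (a : ℂ) : ℂ → ℂ := mobius (φ a) ∘ φ ∘ mobius a

theorem mapsTo_conjMap {φ : ℂ → ℂ} {a : ℂ} (hm : Set.MapsTo φ disc disc) (ha : a ∈ disc) : Set.MapsTo (conjMap φ a) disc disc :=
  (mapsTo_mobius (hm ha)).comp (hm.comp (mapsTo_mobius ha))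

theorem differentiableOn_conjMap {φ : ℂ → ℂ} {a : ℂ} (hφ : DifferentiableOn ℂ φ disc) 
    (hm : Set.MapsTo φ disc disc) (ha : a ∈ disc) : DifferentiableOn ℂ (conjMap φ a) disc :=
  (differentiableOn_mobius (hm ha)).comp (hφ.comp (differentiableOn_mobius ha) (mapsTo_mobius ha))
    (hm.comp (mapsTo_mobius ha))

theorem conjMap_zero {φ : ℂ → ℂ} {a : ℂ} : conjMap φ a 0 = 0 := by simp [conjMap]

theorem injOn_conjMap {φ : ℂ → ℂ} {a : ℂ} (hm : Set.MapsTo φ disc disc) (ha : a ∈ disc)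
    (hi : Set.InjOn φ disc) : Set.InjOn (conjMap φ a) disc :=
  (injOn_mobius (hm ha)).comp (hi.comp (injOn_mobius ha) (mapsTo_mobius ha))
    (hm.comp (mapsTo_mobius ha))

/-- The Schwarz–Pick inequality for the pseudohyperbolic distance. -/
theorem norm_mobius_map_le {φ : ℂ → ℂ} (hφ : DifferentiableOn ℂ φ disc)
    (hm : Set.MapsTo φ disc disc) {a z : ℂ} (ha : a ∈ disc) (hz : z ∈ disc) :
    ‖mobius (φ a) (φ z)‖ ≤ ‖mobius a z‖ := by
  have h := Complex.norm_le_norm_of_mapsTo_ball (differentiableOn_conjMap hφ hm ha)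
    (fun z hz => Metric.ball_subset_closedBall (mapsTo_conjMap hm ha hz)) conjMap_zero (norm_lt_one (mobius_mem_disc ha hz))
  simpa only [conjMap, Function.comp, mobius_mobius ha hz] using h

/-- The Schwarz–Pick inequality for the derivative. -/
theorem norm_deriv_mul_le {φ : ℂ → ℂ} (hφ : DifferentiableOn ℂ φ disc)
    (hm : Set.MapsTo φ disc disc) {a : ℂ} (ha : a ∈ disc) :
    ‖deriv φ a‖ * (1 - ‖a‖ ^ 2) ≤ 1 - ‖φ a‖ ^ 2 := by
  have h := Complex.norm_deriv_le_one_of_mapsTo_ball (differentiableOn_conjMap hφ hm ha)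
    (fun z hz => by
      rw [conjMap_zero]; exact Metric.ball_subset_closedBall (mapsTo_conjMap hm ha hz)) one_pos
  have hb := hm ha
  have e : deriv (conjMap φ a) 0 = deriv (mobius (φ a)) (φ a) * (deriv φ a * deriv (mobius a) 0) := by
    rw [conjMap, deriv_comp_disc (differentiableOn_mobius hb)
      (hφ.comp (differentiableOn_mobius ha) (mapsTo_mobius ha)) (hm.comp (mapsTo_mobius ha))
      zero_mem_disc, deriv_comp_disc hφ (differentiableOn_mobius ha) (mapsTo_mobius ha)
      zero_mem_disc]
    simp
  -- With b = φ(a), the outer factors are explicit: |φ_b'(b)| (1 - |b|²) = 1 and |φ_a'(0)| = 1 -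
  -- |a|².
  have h1 := norm_deriv_mobius_mul hb hb
  have h2 := norm_deriv_mobius_mul ha zero_mem_disc
  simp only [mobius_self, mobius_zero_right, norm_zero] at h1 h2
  norm_num at h1 h2
  rw [e, norm_mul, norm_mul, h2] at h
  have hp := one_sub_norm_sq_pos hb
  calc ‖deriv φ a‖ * (1 - ‖a‖ ^ 2) =
      (‖deriv (mobius (φ a)) (φ a)‖ * (1 - ‖φ a‖ ^ 2)) * (‖deriv φ a‖ * (1 - ‖a‖ ^ 2)) := by
        rw [h1, one_mul]
    _ = (‖deriv (mobius (φ a)) (φ a)‖ * (‖deriv φ a‖ * (1 - ‖a‖ ^ 2))) * (1 - ‖φ a‖ ^ 2) := by ring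
    _ ≤ 1 * (1 - ‖φ a‖ ^ 2) := by gcongr
    _ = _ := one_mul _

/-! ### Change of variables, polar coordinates and mean value properties. -/

/-- The change of variables formula for an injective holomorphic map. -/
theorem lintegral_image_holomorphic {φ : ℂ → ℂ} {s : Set ℂ} (hs : MeasurableSet s)
    (hφ : ∀ z ∈ s, DifferentiableAt ℂ φ z) (hi : Set.InjOn φ s) (g : ℂ → ℝ≥0∞) :
    ∫⁻ w in φ '' s, g w = ∫⁻ z in s, ‖deriv φ z‖ₑ ^ 2 * g (φ z) := by
  rw [lintegral_image_eq_lintegral_abs_det_fderiv_mul volume hs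
    (fun z hz => ((hφ z hz).hasDerivAt.hasFDerivAt.restrictScalars ℝ).hasFDerivWithinAt) hi]
  refine lintegral_congr fun z => ?_
  congr 1
  -- Multiplication by c, as a real linear map of the plane, has determinant |c|².
  have h : (((ContinuousLinearMap.toSpanSingleton ℂ (deriv φ z)).restrictScalars ℝ :
      ℂ →L[ℝ] ℂ)).det = ‖deriv φ z‖ ^ 2 := by
    rw [ContinuousLinearMap.det, Complex.sq_norm, Complex.normSq_apply,
      ← LinearMap.det_toMatrix Complex.basisOneI, Matrix.det_fin_two]
    simp [LinearMap.toMatrix_apply]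
  rw [h, abs_of_nonneg (by positivity), ENNReal.ofReal_pow (norm_nonneg _), ofReal_norm]

theorem measurable_indicator_of_continuousOn {α β : Type*} [TopologicalSpace α]
    [MeasurableSpace α] [BorelSpace α] [TopologicalSpace β] [MeasurableSpace β] [BorelSpace β]
    [Zero β] {f : α → β} {s : Set α} (hf : ContinuousOn f s)
    (hs : MeasurableSet s) : Measurable (s.indicator f) := by
  classical
  rw [← Set.piecewise_eq_indicator]
  exact hf.measurable_piecewise continuousOn_const hs

/-- Integration in polar coordinates around `w`. -/
theorem lintegral_polar {u : ℂ → ℝ≥0∞} (hu : Measurable u) (w : ℂ) :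
    ∫⁻ z, u z = ∫⁻ r in Set.Ioi (0 : ℝ), ENNReal.ofReal r *
      ∫⁻ θ in Set.Ioc (-Real.pi) Real.pi, u (circleMap w r θ) := by
  rw [← lintegral_add_left_eq_self u w, ← Complex.lintegral_comp_polarCoord_symm]
  change ∫⁻ p in Set.Ioi (0 : ℝ) ×ˢ Set.Ioo (-Real.pi) Real.pi, _ = _
  rw [Measure.volume_eq_prod, ← Measure.prod_restrict, lintegral_prod]
  · refine lintegral_congr fun r => ?_
    have h : ∀ θ : ℝ, w + Complex.polarCoord.symm (r, θ) = circleMap w r θ := fun θ => by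
      simp [circleMap, Complex.exp_mul_I]
    simp only [h, smul_eq_mul]
    rw [lintegral_const_mul, setLIntegral_congr Ioo_ae_eq_Ioc]
    exact hu.comp (continuous_circleMap w r).measurable
  · simp only [Complex.polarCoord_symm_apply, smul_eq_mul]
    exact Measurable.aemeasurable (by fun_prop)

theorem integral_circle_of_differentiableOn {G : ℂ → ℂ} {w : ℂ} {R r : ℝ}
    (hG : DifferentiableOn ℂ G (Metric.ball w R)) (hr : 0 < r) (hrR : r < R) :
    IntegrableOn (fun θ => G (circleMap w r θ)) (Set.Ioc (-Real.pi) Real.pi) ∧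
    ∫ θ in Set.Ioc (-Real.pi) Real.pi, G (circleMap w r θ) = (2 * Real.pi : ℝ) • G w := by
  have hsub : Metric.closedBall w r ⊆ Metric.ball w R := Metric.closedBall_subset_ball hrR
  constructor
  · have hc : Continuous fun θ => G (circleMap w r θ) :=
      hG.continuousOn.comp_continuous (continuous_circleMap w r)
        fun θ => hsub (circleMap_mem_closedBall w hr.le θ)
    exact (hc.integrableOn_Icc).mono_set Set.Ioc_subset_Icc_self
  · have h : Real.circleAverage G w r = G w := by
      refine DiffContOnCl.circleAverage ?_
      rw [abs_of_pos hr]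
      refine (hG.mono ?_).diffContOnCl
      exact Metric.closure_ball_subset_closedBall.trans hsub
    rw [← h, Real.circleAverage_eq_integral_add (-Real.pi),
      intervalIntegral.integral_comp_add_right (fun θ => G (circleMap w r θ)), smul_smul,
      mul_inv_cancel₀ (by positivity), one_smul, zero_add,
      show 2 * Real.pi + -Real.pi = Real.pi by ring,
      intervalIntegral.integral_of_le (by linarith [Real.pi_pos])]

theorem enorm_le_lintegral_circle {G : ℂ → ℂ} {w : ℂ} {R r : ℝ}
    (hG : DifferentiableOn ℂ G (Metric.ball w R)) (hr : 0 < r) (hrR : r < R) :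
    ENNReal.ofReal (2 * Real.pi) * ‖G w‖ₑ ≤
      ∫⁻ θ in Set.Ioc (-Real.pi) Real.pi, ‖G (circleMap w r θ)‖ₑ := by
  refine le_trans (le_of_eq ?_) (enorm_integral_le_lintegral_enorm _)
  rw [(integral_circle_of_differentiableOn hG hr hrR).2, enorm_smul,
    Real.enorm_of_nonneg (by positivity)]

theorem lintegral_circle_re {G : ℂ → ℂ} {w : ℂ} {R r : ℝ}
    (hG : DifferentiableOn ℂ G (Metric.ball w R)) (hpos : ∀ z ∈ Metric.ball w R, 0 ≤ (G z).re)
    (hr : 0 < r) (hrR : r < R) :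
    ∫⁻ θ in Set.Ioc (-Real.pi) Real.pi, ENNReal.ofReal (G (circleMap w r θ)).re =
      ENNReal.ofReal (2 * Real.pi * (G w).re) := by
  obtain ⟨h1, h2⟩ := integral_circle_of_differentiableOn hG hr hrR
  have h3 : ∫ θ in Set.Ioc (-Real.pi) Real.pi, (G (circleMap w r θ)).re =
      2 * Real.pi * (G w).re := by
    have := integral_re h1
    simp only [RCLike.re_to_complex] at this
    rw [this, h2, Complex.smul_re, smul_eq_mul]
  have h4 : IntegrableOn (fun θ => (G (circleMap w r θ)).re) (Set.Ioc (-Real.pi) Real.pi) := h1.re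
  rw [← h3, ofReal_integral_eq_lintegral_ofReal h4]
  · refine ae_of_all _ fun θ => hpos _ ?_
    exact Metric.closedBall_subset_ball hrR (circleMap_mem_closedBall w hr.le θ)

theorem lintegral_Ioo_ofReal_id {R : ℝ} (hR : 0 ≤ R) :
    ∫⁻ r in Set.Ioo 0 R, ENNReal.ofReal r = ENNReal.ofReal (R ^ 2 / 2) := by
  have h : ∫ r in Set.Ioc 0 R, r = R ^ 2 / 2 := by
    rw [← intervalIntegral.integral_of_le hR, integral_id]; ring
  rw [setLIntegral_congr Ioo_ae_eq_Ioc, ← h, ofReal_integral_eq_lintegral_ofReal]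
  · exact (continuous_id.integrableOn_Icc).mono_set Set.Ioc_subset_Icc_self
  · exact (ae_restrict_iff' measurableSet_Ioc).2 (ae_of_all _ fun r hr => hr.1.le)

/-- The sub-mean value property of the modulus of a holomorphic function on a ball. -/
theorem enorm_mul_volume_le {G : ℂ → ℂ} {w : ℂ} {R : ℝ} (hR : 0 ≤ R)
    (hG : DifferentiableOn ℂ G (Metric.ball w R)) :
    ‖G w‖ₑ * volume (Metric.ball w R) ≤ ∫⁻ z in Metric.ball w R, ‖G z‖ₑ := by
  have hm : Measurable ((Metric.ball w R).indicator fun z => ‖G z‖ₑ) :=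
    measurable_indicator_of_continuousOn hG.continuousOn.enorm measurableSet_ball
  rw [← lintegral_indicator measurableSet_ball, lintegral_polar hm w]
  have hv : volume (Metric.ball w R) = ∫⁻ r in Set.Ioo 0 R,
      ENNReal.ofReal r * ENNReal.ofReal (2 * Real.pi) := by
    rw [lintegral_mul_const _ (by fun_prop), lintegral_Ioo_ofReal_id hR, Complex.volume_ball,
      ← ENNReal.ofReal_mul (by positivity), ← ENNReal.ofReal_pow hR,
      show (NNReal.pi : ℝ≥0∞) = ENNReal.ofReal Real.pi from (ENNReal.ofReal_coe_nnreal).symm,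
      ← ENNReal.ofReal_mul (by positivity)]
    congr 1
    ring
  rw [hv, ← lintegral_const_mul _ (by fun_prop)]
  refine le_trans (setLIntegral_mono' measurableSet_Ioo fun r hr => ?_)
    (lintegral_mono_set fun r hr => hr.1)
  have h := enorm_le_lintegral_circle hG hr.1 hr.2
  calc ‖G w‖ₑ * (ENNReal.ofReal r * ENNReal.ofReal (2 * Real.pi)) =
      ENNReal.ofReal r * (ENNReal.ofReal (2 * Real.pi) * ‖G w‖ₑ) := by ring
    _ ≤ _ := by
      gcongr
      refine h.trans (le_of_eq (lintegral_congr fun θ => ?_))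
      rw [Set.indicator_of_mem]
      exact Metric.closedBall_subset_ball hr.2 (circleMap_mem_closedBall w hr.1.le θ)

/-- The sub-mean value property of the `p`-th power of the modulus of a holomorphic function. -/
theorem enorm_rpow_mul_volume_le {G : ℂ → ℂ} {w : ℂ} {R p : ℝ} (hR : 0 < R) (hp : 1 ≤ p)
    (hG : DifferentiableOn ℂ G (Metric.ball w R)) :
    ‖G w‖ₑ ^ p * volume (Metric.ball w R) ≤ ∫⁻ z in Metric.ball w R, ‖G z‖ₑ ^ p := by
  have hp0 : 0 < p := by linarith
  set V := volume (Metric.ball w R) with hV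
  have hV0 : V ≠ 0 := (Metric.measure_ball_pos volume w hR).ne'
  have hVt : V ≠ ∞ := measure_ball_lt_top.ne
  have hm : AEMeasurable (fun z => ‖G z‖ₑ ^ p) (volume.restrict (Metric.ball w R)) :=
    (hG.continuousOn.enorm.aemeasurable measurableSet_ball).pow_const _
  -- Hölder against the constant 1. Raising the case of exponent 1 to the power p then leaves a
  -- surplus factor V^(p-1), cancelled at the end.
  have h1 := ENNReal.lintegral_mul_norm_pow_le (p := 1 / p) (q := 1 - 1 / p) hm
    (aemeasurable_const (b := (1 : ℝ≥0∞))) (by positivity)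
    (by rw [sub_nonneg, div_le_one hp0]; exact hp) (by ring)
  simp only [ENNReal.one_rpow, mul_one, lintegral_one, Measure.restrict_apply_univ] at h1
  have e : ∀ z, (‖G z‖ₑ ^ p) ^ (1 / p) = ‖G z‖ₑ := fun z => by
    rw [← ENNReal.rpow_mul, mul_one_div_cancel hp0.ne', ENNReal.rpow_one]
  simp only [e] at h1
  have h2 := ENNReal.rpow_le_rpow ((enorm_mul_volume_le hR.le hG).trans h1) hp0.le
  rw [ENNReal.mul_rpow_of_nonneg _ _ hp0.le, ENNReal.mul_rpow_of_nonneg _ _ hp0.le,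
    ← ENNReal.rpow_mul, ← ENNReal.rpow_mul, one_div_mul_cancel hp0.ne', ENNReal.rpow_one,
    sub_mul, one_div_mul_cancel hp0.ne', one_mul, ← hV] at h2
  have h3 : V ^ p = V * V ^ (p - 1) := by
    have := ENNReal.rpow_add 1 (p - 1) hV0 hVt
    rwa [add_sub_cancel, ENNReal.rpow_one] at this
  rw [h3, ← mul_assoc] at h2
  exact (ENNReal.mul_le_mul_iff_left (by simp [ENNReal.rpow_eq_zero_iff, hV0, hVt])
    (ENNReal.rpow_ne_top_of_nonneg (by linarith) hVt)).1 h2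

/-- Mean value property over annuli for the nonnegative real part of a holomorphic function. -/
theorem lintegral_annulus_re_le {G : ℂ → ℂ} (hG : DifferentiableOn ℂ G disc)
    (hpos : ∀ z ∈ disc, 0 ≤ (G z).re) {δ : ℝ} (hδ : 0 ≤ δ) :
    ∫⁻ z in {z | z ∈ disc ∧ 1 - ‖z‖ < δ}, ENNReal.ofReal (G z).re ≤
      ENNReal.ofReal (2 * Real.pi * δ * (G 0).re) := by
  set S : Set ℂ := {z | z ∈ disc ∧ 1 - ‖z‖ < δ} with hS
  have hSo : IsOpen S := isOpen_disc.inter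
    (isOpen_lt (continuous_const.sub continuous_norm) continuous_const)
  have hm : Measurable (S.indicator fun z => ENNReal.ofReal (G z).re) := by
    refine measurable_indicator_of_continuousOn ?_ hSo.measurableSet
    refine ENNReal.continuous_ofReal.comp_continuousOn
      (Complex.continuous_re.comp_continuousOn (hG.continuousOn.mono fun z hz => hz.1))
  rw [← lintegral_indicator hSo.measurableSet, lintegral_polar hm 0]
  have key : ∀ r ∈ Set.Ioi (0 : ℝ), ENNReal.ofReal r * ∫⁻ θ in Set.Ioc (-Real.pi) Real.pi,
      S.indicator (fun z => ENNReal.ofReal (G z).re) (circleMap 0 r θ) ≤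
      (Set.Ioo (1 - δ) 1).indicator (fun _ => ENNReal.ofReal (2 * Real.pi * (G 0).re)) r := by
    intro r hr
    have hr0 : (0 : ℝ) < r := hr
    have hn : ∀ θ, ‖circleMap 0 r θ‖ = r := fun θ => by simp [abs_of_pos hr0]
    have hiff : ∀ θ, circleMap 0 r θ ∈ S ↔ r ∈ Set.Ioo (1 - δ) 1 := fun θ => by
      simp only [hS, Set.mem_ofPred_eq, mem_ball_zero_iff, hn, Set.mem_Ioo]
      constructor
      · rintro ⟨h1, h2⟩; exact ⟨by linarith, h1⟩
      · rintro ⟨h1, h2⟩; exact ⟨h2, by linarith⟩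
    by_cases h : r ∈ Set.Ioo (1 - δ) 1
    · rw [Set.indicator_of_mem h]
      rw [lintegral_congr fun θ => Set.indicator_of_mem ((hiff θ).2 h) _, lintegral_circle_re hG hpos hr0 h.2]
      -- Every circle has the same mean, and the Jacobian factor r is at most 1, so only the width
      -- of the annulus remains.
      exact mul_le_of_le_one_left' (by simpa using h.2.le)
    · rw [lintegral_congr fun θ => Set.indicator_of_notMem (mt (hiff θ).1 h) _]
      simp
  calc _ ≤ ∫⁻ r in Set.Ioi (0 : ℝ), (Set.Ioo (1 - δ) 1).indicator
        (fun _ => ENNReal.ofReal (2 * Real.pi * (G 0).re)) r :=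
        setLIntegral_mono' measurableSet_Ioi key
    _ ≤ ∫⁻ r, (Set.Ioo (1 - δ) 1).indicator
        (fun _ => ENNReal.ofReal (2 * Real.pi * (G 0).re)) r := setLIntegral_le_lintegral _ _
    _ = ENNReal.ofReal (2 * Real.pi * (G 0).re) * ENNReal.ofReal δ := by
        rw [lintegral_indicator measurableSet_Ioo, setLIntegral_const, Real.volume_Ioo,
          sub_sub_cancel]
    _ = _ := by
        rw [← ENNReal.ofReal_mul' hδ]; congr 1; ring

theorem enorm_rpow (x : ℂ) {p : ℝ} (hp : 0 ≤ p) : ‖x‖ₑ ^ p = ENNReal.ofReal (‖x‖ ^ p) := by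
  rw [← ofReal_norm, ENNReal.ofReal_rpow_of_nonneg (norm_nonneg _) hp]

/-! ### The weighted integrals and preimages of Whitney discs. -/

/-- The weight of the integral `oscInt`. -/
def weight (p : ℝ) (a z : ℂ) : ℝ≥0∞ :=
  ENNReal.ofReal ((1 - ‖z‖ ^ 2) ^ (p - 2) * (1 - ‖mobius a z‖ ^ 2))

theorem measurable_mobius (a : ℂ) : Measurable (mobius a) := by
  unfold mobius
  fun_prop

theorem measurable_weight (p : ℝ) (a : ℂ) : Measurable (weight p a) := by
  have := measurable_mobius a
  unfold weight
  fun_prop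

/-- The integral `oscInt` for a function `u` in place of the modulus of the derivative, with respect
to Lebesgue measure. -/
def osc (p : ℝ) (u : ℂ → ℝ≥0∞) (a : ℂ) : ℝ≥0∞ := ∫⁻ z in disc, u z ^ p * weight p a z

theorem measurableSet_disc : MeasurableSet disc := isOpen_disc.measurableSet

theorem oscInt_eq {p : ℝ} (hp : 0 ≤ p) (f : ℂ → ℂ) (a : ℂ) :
    oscInt p f a = (ENNReal.ofReal Real.pi)⁻¹ * osc p (fun z => ‖deriv f z‖ₑ) a := by
  rw [oscInt, area, lintegral_smul_measure, osc, smul_eq_mul]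
  congr 1
  refine setLIntegral_congr_fun measurableSet_disc fun z hz => ?_
  simp only [weight]
  rw [enorm_rpow _ hp, ← ENNReal.ofReal_mul (by positivity), mul_assoc]

theorem weight_zero {p : ℝ} {z : ℂ} (hz : z ∈ disc) :
    weight p 0 z = ENNReal.ofReal ((1 - ‖z‖ ^ 2) ^ (p - 1)) := by
  rw [weight, norm_mobius_zero_left, ← Real.rpow_add_one (one_sub_norm_sq_pos hz).ne']
  congr 2
  ring

theorem re_herglotz (u : ℂ) :
    ((1 + u) / (1 - u)).re = (1 - ‖u‖ ^ 2) / ‖1 - u‖ ^ 2 := by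
  rw [Complex.div_re, ← add_div, ← Complex.normSq_eq_norm_sq, ← Complex.normSq_eq_norm_sq]
  congr 1
  simp only [Complex.normSq_apply, Complex.sub_re, Complex.sub_im, Complex.add_re,
    Complex.add_im, Complex.one_re, Complex.one_im]
  ring

/-- The points of the disc which `φ` maps to a point whose Whitney disc contains `ζ`. -/
def whitneyPreimage (φ : ℂ → ℂ) (ζ : ℂ) : Set ℂ := {z | z ∈ disc ∧ ‖ζ - φ z‖ < (1 - ‖φ z‖) / 2}

theorem isOpen_whitneyPreimage {φ : ℂ → ℂ} (hφ : DifferentiableOn ℂ φ disc) (ζ : ℂ) :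
    IsOpen (whitneyPreimage φ ζ) := by
  have h : ContinuousOn (fun z => (1 - ‖φ z‖) / 2 - ‖ζ - φ z‖) disc := by
    have := hφ.continuousOn
    fun_prop
  have h2 := h.isOpen_inter_preimage isOpen_disc (isOpen_Ioi (a := (0 : ℝ)))
  convert h2 using 1
  ext z
  simp [whitneyPreimage]

/-- By the triangle inequality, the distance to the boundary is comparable at the centre and at any
other point of a Whitney disc. Many constants below come from these two factors. -/
theorem dist_bounds {ζ w : ℂ} (h : ‖ζ - w‖ < (1 - ‖w‖) / 2) :
    1 - ‖w‖ < 2 * (1 - ‖ζ‖) ∧ 1 - ‖ζ‖ ≤ 3 / 2 * (1 - ‖w‖) := by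
  have h1 := norm_sub_norm_le ζ w
  have h2 := norm_sub_norm_le w ζ
  rw [norm_sub_rev] at h2
  constructor <;> linarith

/-- By univalence the integral is the area of the image, and the image lies in the ball around ζ
that touches the unit circle. -/
theorem lintegral_deriv_sq_whitneyPreimage_le {φ : ℂ → ℂ} (hφ : DifferentiableOn ℂ φ disc)
    (hi : Set.InjOn φ disc) {ζ : ℂ} (hζ : ζ ∈ disc) :
    ∫⁻ z in whitneyPreimage φ ζ, ‖deriv φ z‖ₑ ^ 2 ≤
      ENNReal.ofReal (Real.pi * (1 - ‖ζ‖) ^ 2) := by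
  have hd : 0 < 1 - ‖ζ‖ := by have := norm_lt_one hζ; linarith
  have h := lintegral_image_holomorphic (isOpen_whitneyPreimage hφ ζ).measurableSet
    (fun z hz => differentiableAt_of_disc hφ hz.1) (hi.mono fun z hz => hz.1) fun _ => 1
  simp only [mul_one, lintegral_one, Measure.restrict_apply_univ] at h
  rw [← h]
  calc volume (φ '' whitneyPreimage φ ζ) ≤ volume (Metric.ball ζ (1 - ‖ζ‖)) := by
        refine measure_mono ?_
        rintro _ ⟨z, hz, rfl⟩
        rw [mem_ball_iff_norm, norm_sub_rev]
        have := (dist_bounds hz.2).1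
        linarith [hz.2]
    _ = _ := by
        rw [Complex.volume_ball, ← ENNReal.ofReal_pow hd.le,
          show (NNReal.pi : ℝ≥0∞) = ENNReal.ofReal Real.pi from (ENNReal.ofReal_coe_nnreal).symm,
          ← ENNReal.ofReal_mul (by positivity), mul_comm]

theorem norm_map_le {φ : ℂ → ℂ} (hφ : DifferentiableOn ℂ φ disc) (hm : Set.MapsTo φ disc disc)
    (h0 : φ 0 = 0) {z : ℂ} (hz : z ∈ disc) : ‖φ z‖ ≤ ‖z‖ := by
  have := norm_mobius_map_le hφ hm zero_mem_disc hz
  rwa [h0, norm_mobius_zero_left, norm_mobius_zero_left] at this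

/-- The positive harmonic function Re G, a Poisson-type kernel at ζ composed with φ, is at least
1/(9d) on the set, where d = 1 - |ζ|, and equals 1 at the origin. By Schwarz the set lies in an
annulus of width 2d, over which Re G has integral at most 4πd. Chebyshev's inequality gives 9d ·
4πd. Univalence plays no role. -/
theorem volume_whitneyPreimage_le {φ : ℂ → ℂ} (hφ : DifferentiableOn ℂ φ disc)
    (hm : Set.MapsTo φ disc disc) (h0 : φ 0 = 0) {ζ : ℂ} (hζ : ζ ∈ disc) :
    volume (whitneyPreimage φ ζ) ≤ ENNReal.ofReal (36 * Real.pi * (1 - ‖ζ‖) ^ 2) := by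
  set d := 1 - ‖ζ‖ with hdef
  have hζ1 := norm_lt_one hζ
  have hd : 0 < d := by linarith
  set G : ℂ → ℂ := fun z => (1 + (starRingEnd ℂ) ζ * φ z) / (1 - (starRingEnd ℂ) ζ * φ z) with hG
  have hu : ∀ z ∈ disc, ‖(starRingEnd ℂ) ζ * φ z‖ ≤ ‖ζ‖ := fun z hz => by
    rw [norm_mul, RCLike.norm_conj]
    exact mul_le_of_le_one_right (norm_nonneg _) (norm_lt_one (hm hz)).le
  have hGd : DifferentiableOn ℂ G disc := by
    refine DifferentiableOn.div ?_ ?_ fun z hz => mobius_denom_ne_zero hζ (hm hz)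
    · exact (hφ.const_mul _).const_add _
    · exact (hφ.const_mul _).const_sub _
  have hre : ∀ z, (G z).re = (1 - ‖(starRingEnd ℂ) ζ * φ z‖ ^ 2) /
      ‖1 - (starRingEnd ℂ) ζ * φ z‖ ^ 2 := fun z => re_herglotz _
  have hnum : ∀ z ∈ disc, d ≤ 1 - ‖(starRingEnd ℂ) ζ * φ z‖ ^ 2 := fun z hz => by
    have := hu z hz
    nlinarith [norm_nonneg ((starRingEnd ℂ) ζ * φ z), norm_nonneg ζ]
  have hpos : ∀ z ∈ disc, 0 ≤ (G z).re := fun z hz => by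
    rw [hre]
    have := hnum z hz
    exact div_nonneg (by linarith) (by positivity)
  have hlow : ∀ z ∈ whitneyPreimage φ ζ, 1 ≤ 9 * d * (G z).re := by
    intro z hz
    -- The denominator is (1 - |ζ|²) + conj ζ (ζ - φ z), of size at most 2d + d.
    have h1 : ‖1 - (starRingEnd ℂ) ζ * φ z‖ ≤ 3 * d := by
      have e : 1 - (starRingEnd ℂ) ζ * φ z =
          ((1 - ‖ζ‖ ^ 2 : ℝ) : ℂ) + (starRingEnd ℂ) ζ * (ζ - φ z) := by
        have h2 : (starRingEnd ℂ) ζ * ζ = (‖ζ‖ : ℂ) ^ 2 := Complex.conj_mul' ζ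
        rw [mul_sub, h2]; push_cast; ring
      rw [e]
      refine (norm_add_le _ _).trans ?_
      rw [Complex.norm_real, norm_mul, RCLike.norm_conj,
        Real.norm_of_nonneg (one_sub_norm_sq_pos hζ).le]
      have h3 := (dist_bounds hz.2).1
      have h4 : ‖ζ - φ z‖ ≤ d := by linarith [hz.2]
      have h5 : ‖ζ‖ * ‖ζ - φ z‖ ≤ 1 * d := by gcongr
      nlinarith [norm_nonneg ζ]
    have h6 := mobius_denom_norm_pos hζ (hm hz.1)
    rw [hre, ← mul_div_assoc, le_div_iff₀ (by positivity), one_mul]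
    calc ‖1 - (starRingEnd ℂ) ζ * φ z‖ ^ 2 ≤ (3 * d) ^ 2 := by gcongr
      _ = 9 * d * d := by ring
      _ ≤ _ := by have := hnum z hz.1; gcongr
  have hG0 : (G 0).re = 1 := by simp [hG, h0]
  have hA := (isOpen_whitneyPreimage hφ ζ).measurableSet
  have hsub : whitneyPreimage φ ζ ⊆ {z | z ∈ disc ∧ 1 - ‖z‖ < 2 * d} := fun z hz => by
    have h3 := (dist_bounds hz.2).1
    have h4 := norm_map_le hφ hm h0 hz.1
    exact ⟨hz.1, by linarith⟩
  calc volume (whitneyPreimage φ ζ) = ∫⁻ z in whitneyPreimage φ ζ, 1 := by simp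
    _ ≤ ∫⁻ z in whitneyPreimage φ ζ, ENNReal.ofReal (9 * d) * ENNReal.ofReal (G z).re := by
        refine setLIntegral_mono' hA fun z hz => ?_
        rw [← ENNReal.ofReal_mul (by positivity), ← ENNReal.ofReal_one]
        exact ENNReal.ofReal_le_ofReal (hlow z hz)
    _ = ENNReal.ofReal (9 * d) * ∫⁻ z in whitneyPreimage φ ζ, ENNReal.ofReal (G z).re := by
        rw [lintegral_const_mul' _ _ ENNReal.ofReal_ne_top]
    _ ≤ ENNReal.ofReal (9 * d) * ENNReal.ofReal (2 * Real.pi * (2 * d) * (G 0).re) := by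
        gcongr
        exact (lintegral_mono_set hsub).trans (lintegral_annulus_re_le hGd hpos (by positivity))
    _ = _ := by
        rw [← ENNReal.ofReal_mul (by positivity), hG0]
        congr 1
        ring

/-- For p ≤ 2, Hölder interpolates between the area of the image and the area of the set. For p > 2
the surplus power |φ'|^(p-2) is absorbed by Schwarz–Pick. The factor 4d bounds 1 - |z|² and 1 - |φ
z|² on the set. -/
theorem lintegral_whitneyPreimage_le {φ : ℂ → ℂ} (hφ : DifferentiableOn ℂ φ disc)
    (hm : Set.MapsTo φ disc disc) (hi : Set.InjOn φ disc) (h0 : φ 0 = 0) {p : ℝ} (hp : 1 ≤ p)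
    {ζ : ℂ} (hζ : ζ ∈ disc) :
    ∫⁻ z in whitneyPreimage φ ζ, ‖deriv φ z‖ₑ ^ p * weight p 0 z ≤
      ENNReal.ofReal (36 * Real.pi * (1 - ‖ζ‖) ^ 2 * (4 * (1 - ‖ζ‖)) ^ (p - 1)) := by
  set d := 1 - ‖ζ‖ with hdef
  have hζ1 := norm_lt_one hζ
  have hd : 0 < d := by linarith
  have hA := (isOpen_whitneyPreimage hφ ζ).measurableSet
  have hz4 : ∀ z ∈ whitneyPreimage φ ζ, 1 - ‖φ z‖ ^ 2 ≤ 4 * d ∧ 1 - ‖z‖ ^ 2 ≤ 4 * d := by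
    intro z hz
    have h3 := (dist_bounds hz.2).1
    have h4 := norm_map_le hφ hm h0 hz.1
    have h5 := norm_lt_one hz.1
    constructor <;> nlinarith [norm_nonneg z, norm_nonneg (φ z)]
  have hJ := lintegral_deriv_sq_whitneyPreimage_le hφ hi hζ
  have hV := volume_whitneyPreimage_le hφ hm h0 hζ
  rw [← hdef] at hJ hV
  -- The area bound is weakened to the same X as the volume bound, so that the Hölder powers X^(p/2)
  -- and X^(1-p/2) recombine to X.
  have hJ' : ∫⁻ z in whitneyPreimage φ ζ, ‖deriv φ z‖ₑ ^ 2 ≤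
      ENNReal.ofReal (36 * Real.pi * d ^ 2) := hJ.trans (ENNReal.ofReal_le_ofReal (by
        have := Real.pi_pos; nlinarith [mul_pos this (pow_pos hd 2)]))
  set X := ENNReal.ofReal (36 * Real.pi * d ^ 2) with hX
  have hX0 : X ≠ 0 := by
    rw [hX, ne_eq, ENNReal.ofReal_eq_zero, not_le]
    positivity
  rw [ENNReal.ofReal_mul (by positivity), ← hX, mul_comm X]
  rcases le_or_gt p 2 with hp2 | hp2
  · calc ∫⁻ z in whitneyPreimage φ ζ, ‖deriv φ z‖ₑ ^ p * weight p 0 z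
        ≤ ∫⁻ z in whitneyPreimage φ ζ, ENNReal.ofReal ((4 * d) ^ (p - 1)) *
          ((‖deriv φ z‖ₑ ^ 2) ^ (p / 2) * 1 ^ (1 - p / 2)) := by
          refine setLIntegral_mono' hA fun z hz => ?_
          rw [weight_zero hz.1, mul_comm, ENNReal.one_rpow, mul_one, ← ENNReal.rpow_natCast,
            ← ENNReal.rpow_mul]
          have : ((2 : ℕ) : ℝ) * (p / 2) = p := by push_cast; ring
          rw [this]
          have := (one_sub_norm_sq_pos hz.1).le
          have := (hz4 z hz).2
          have : 0 ≤ p - 1 := by linarith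
          gcongr
      _ = ENNReal.ofReal ((4 * d) ^ (p - 1)) * ∫⁻ z in whitneyPreimage φ ζ,
          (‖deriv φ z‖ₑ ^ 2) ^ (p / 2) * 1 ^ (1 - p / 2) := by
          rw [lintegral_const_mul' _ _ ENNReal.ofReal_ne_top]
      _ ≤ ENNReal.ofReal ((4 * d) ^ (p - 1)) * (X ^ (p / 2) * X ^ (1 - p / 2)) := by
          gcongr
          have hmd := measurable_deriv φ
          refine (ENNReal.lintegral_mul_norm_pow_le (by fun_prop) (by fun_prop) (by linarith)
            (by linarith) (by ring)).trans ?_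
          have : 0 ≤ 1 - p / 2 := by linarith
          have : 0 ≤ p / 2 := by linarith
          simp only [lintegral_one, Measure.restrict_apply_univ]
          gcongr
      _ = _ := by
          rw [← ENNReal.rpow_add _ _ hX0 ENNReal.ofReal_ne_top, add_sub_cancel, ENNReal.rpow_one]
  · calc ∫⁻ z in whitneyPreimage φ ζ, ‖deriv φ z‖ₑ ^ p * weight p 0 z
        ≤ ∫⁻ z in whitneyPreimage φ ζ, ENNReal.ofReal ((4 * d) ^ (p - 1)) *
          ‖deriv φ z‖ₑ ^ 2 := by
          refine setLIntegral_mono' hA fun z hz => ?_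
          have hz0 := one_sub_norm_sq_pos hz.1
          rw [weight_zero hz.1, enorm_rpow _ (by linarith), ← ofReal_norm,
            ← ENNReal.ofReal_pow (norm_nonneg _), ← ENNReal.ofReal_mul (by positivity),
            ← ENNReal.ofReal_mul (by positivity)]
          refine ENNReal.ofReal_le_ofReal ?_
          have h1 := norm_deriv_mul_le hφ hm hz.1
          have e1 : ‖deriv φ z‖ ^ p = ‖deriv φ z‖ ^ (p - 2) * ‖deriv φ z‖ ^ 2 := by
            rw [← Real.rpow_natCast, ← Real.rpow_add_of_nonneg (norm_nonneg _) (by linarith)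
              (by norm_num)]
            congr 1; push_cast; ring
          have e2 : ∀ x : ℝ, 0 < x → x ^ (p - 1) = x ^ (p - 2) * x := fun x hx => by
            rw [← Real.rpow_add_one hx.ne']; congr 1; ring
          rw [e1, e2 _ hz0, e2 _ (by positivity)]
          calc ‖deriv φ z‖ ^ (p - 2) * ‖deriv φ z‖ ^ 2 * ((1 - ‖z‖ ^ 2) ^ (p - 2) * (1 - ‖z‖ ^ 2))
              = (‖deriv φ z‖ * (1 - ‖z‖ ^ 2)) ^ (p - 2) * (1 - ‖z‖ ^ 2) * ‖deriv φ z‖ ^ 2 := by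
                rw [Real.mul_rpow (norm_nonneg _) hz0.le]; ring
            _ ≤ (4 * d) ^ (p - 2) * (4 * d) * ‖deriv φ z‖ ^ 2 := by
                exact mul_le_mul_of_nonneg_right (mul_le_mul
                  (Real.rpow_le_rpow (by positivity) (h1.trans (hz4 z hz).1) (by linarith))
                  (hz4 z hz).2 hz0.le (by positivity)) (by positivity)
      _ = ENNReal.ofReal ((4 * d) ^ (p - 1)) * ∫⁻ z in whitneyPreimage φ ζ,
          ‖deriv φ z‖ₑ ^ 2 := by
          rw [lintegral_const_mul' _ _ ENNReal.ofReal_ne_top]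
      _ ≤ _ := by gcongr

/-! ### Composition with univalent maps. -/

/-- The constant in the bound of univalent composition operators. -/
def compConst (p : ℝ) : ℝ≥0 := Real.toNNReal (324 * 4 ^ (p - 1))

theorem ball_whitney_subset {w : ℂ} : Metric.ball w ((1 - ‖w‖) / 2) ⊆ disc := fun ζ h => by
  rw [mem_ball_iff_norm] at h
  have h1 := norm_sub_norm_le ζ w
  have h2 : 0 < 1 - ‖w‖ := by linarith [norm_nonneg (ζ - w)]
  rw [mem_ball_zero_iff]
  linarith

theorem ofReal_pi : (NNReal.pi : ℝ≥0∞) = ENNReal.ofReal Real.pi := (ENNReal.ofReal_coe_nnreal).symm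

/-- The sub-mean value property on Whitney discs. -/
theorem enorm_rpow_le_whitney {F : ℂ → ℂ} (hF : DifferentiableOn ℂ F disc) {p : ℝ} (hp : 1 ≤ p)
    {w : ℂ} (hw : w ∈ disc) :
    ‖F w‖ₑ ^ p ≤ ∫⁻ ζ in Metric.ball w ((1 - ‖w‖) / 2),
      ‖F ζ‖ₑ ^ p * ENNReal.ofReal (9 / (Real.pi * (1 - ‖ζ‖) ^ 2)) := by
  have hw1 := norm_lt_one hw
  set R := (1 - ‖w‖) / 2 with hR
  have hR0 : 0 < R := by rw [hR]; linarith
  have h := enorm_rpow_mul_volume_le hR0 hp (hF.mono ball_whitney_subset)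
  have hv : volume (Metric.ball w R) = ENNReal.ofReal (Real.pi * R ^ 2) := by
    rw [Complex.volume_ball, ofReal_pi, ← ENNReal.ofReal_pow hR0.le,
      ← ENNReal.ofReal_mul (by positivity), mul_comm]
  have hinv : ENNReal.ofReal (Real.pi * R ^ 2) * ENNReal.ofReal (Real.pi * R ^ 2)⁻¹ = 1 := by
    rw [← ENNReal.ofReal_mul (by positivity), mul_inv_cancel₀ (by positivity), ENNReal.ofReal_one]
  calc ‖F w‖ₑ ^ p = ‖F w‖ₑ ^ p * volume (Metric.ball w R) *
        ENNReal.ofReal (Real.pi * R ^ 2)⁻¹ := by rw [hv, mul_assoc, hinv, mul_one]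
    _ ≤ (∫⁻ z in Metric.ball w R, ‖F z‖ₑ ^ p) * ENNReal.ofReal (Real.pi * R ^ 2)⁻¹ := by gcongr
    _ = ∫⁻ z in Metric.ball w R, ‖F z‖ₑ ^ p * ENNReal.ofReal (Real.pi * R ^ 2)⁻¹ := by
        rw [lintegral_mul_const' _ _ ENNReal.ofReal_ne_top]
    _ ≤ _ := by
        refine setLIntegral_mono' measurableSet_ball fun ζ hζ => ?_
        gcongr
        rw [mem_ball_iff_norm] at hζ
        have h1 := (dist_bounds hζ).2
        have h2 : 0 < 1 - ‖ζ‖ := by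
          have := (dist_bounds hζ).1
          linarith
        rw [← one_div, div_le_div_iff₀ (by positivity) (by positivity)]
        -- Since 1 - |ζ| ≤ 3R on the ball, the normalization 1/(πR²) is at most 9/(π(1 - |ζ|)²); the
        -- latter depends on ζ only, as Fubini will need.
        have h3 : (1 - ‖ζ‖) ^ 2 ≤ (3 * R) ^ 2 := by
          gcongr
          rw [hR]; linarith
        nlinarith [Real.pi_pos]

theorem isOpen_whitneyGraph {φ : ℂ → ℂ} (hφ : DifferentiableOn ℂ φ disc) :
    IsOpen {x : ℂ × ℂ | x.1 ∈ whitneyPreimage φ x.2} := by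
  have h : ContinuousOn (fun x : ℂ × ℂ => (1 - ‖φ x.1‖) / 2 - ‖x.2 - φ x.1‖)
      (disc ×ˢ Set.univ) := by
    have : ContinuousOn (fun x : ℂ × ℂ => φ x.1) (disc ×ˢ Set.univ) :=
      hφ.continuousOn.comp continuousOn_fst fun x hx => hx.1
    exact ((continuousOn_const.sub this.norm).div_const _).sub (continuousOn_snd.sub this).norm
  have h2 := h.isOpen_inter_preimage (isOpen_disc.prod isOpen_univ) (isOpen_Ioi (a := (0 : ℝ)))
  convert h2 using 1
  ext z
  simp [whitneyPreimage]

/-- Composition with a univalent self-map of the disc fixing the origin is bounded for the integral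
at the origin. -/
theorem lintegral_comp_le {F φ : ℂ → ℂ} (hF : DifferentiableOn ℂ F disc) (hFm : Measurable F)
    (hφ : DifferentiableOn ℂ φ disc) (hm : Set.MapsTo φ disc disc) (hi : Set.InjOn φ disc)
    (h0 : φ 0 = 0) {p : ℝ} (hp : 1 ≤ p) :
    ∫⁻ z in disc, ‖F (φ z)‖ₑ ^ p * (‖deriv φ z‖ₑ ^ p * weight p 0 z) ≤
      compConst p * ∫⁻ z in disc, ‖F z‖ₑ ^ p * weight p 0 z := by
  set S : Set (ℂ × ℂ) := {x : ℂ × ℂ | x.1 ∈ whitneyPreimage φ x.2}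
  -- The incidence kernel "ζ lies in the Whitney disc of φ z" puts both domains of integration into
  -- the integrand. Its support is open, hence measurable.
  set κ : ℂ → ℂ → ℝ≥0∞ := fun z ζ => S.indicator (fun _ => 1) (z, ζ) with hκ
  have hκm : Measurable (Function.uncurry κ) :=
    measurable_const.indicator (isOpen_whitneyGraph hφ).measurableSet
  set H : ℂ → ℝ≥0∞ := fun ζ => ‖F ζ‖ₑ ^ p * ENNReal.ofReal (9 / (Real.pi * (1 - ‖ζ‖) ^ 2)) with hH
  have hHm : Measurable H := by fun_prop
  set W : ℂ → ℝ≥0∞ := fun z => ‖deriv φ z‖ₑ ^ p * weight p 0 z with hW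
  have hWm : Measurable W := by
    have := measurable_deriv φ
    have := measurable_weight p 0
    fun_prop
  have step1 : ∀ z ∈ disc, ‖F (φ z)‖ₑ ^ p ≤ ∫⁻ ζ in disc, κ z ζ * H ζ := by
    intro z hz
    refine (enorm_rpow_le_whitney hF hp (hm hz)).trans ?_
    rw [← lintegral_indicator measurableSet_ball, ← lintegral_indicator measurableSet_disc]
    refine lintegral_mono fun ζ => ?_
    by_cases h : ζ ∈ Metric.ball (φ z) ((1 - ‖φ z‖) / 2)
    · rw [Set.indicator_of_mem h, Set.indicator_of_mem (ball_whitney_subset h), hκ]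
      have : (z, ζ) ∈ S := ⟨hz, mem_ball_iff_norm.1 h⟩
      simp [Set.indicator_of_mem this, hH]
    · rw [Set.indicator_of_notMem h]; exact zero_le
  have step2 : ∀ ζ ∈ disc, ∫⁻ z in disc, κ z ζ * W z ≤
      ENNReal.ofReal (36 * Real.pi * (1 - ‖ζ‖) ^ 2 * (4 * (1 - ‖ζ‖)) ^ (p - 1)) := by
    intro ζ hζ
    refine le_trans (le_of_eq ?_) (lintegral_whitneyPreimage_le hφ hm hi h0 hp hζ)
    rw [← lintegral_indicator measurableSet_disc,
      ← lintegral_indicator (isOpen_whitneyPreimage hφ ζ).measurableSet]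
    refine lintegral_congr fun z => ?_
    by_cases h : z ∈ whitneyPreimage φ ζ
    · have : (z, ζ) ∈ S := h
      rw [Set.indicator_of_mem h, Set.indicator_of_mem h.1, hκ]
      simp [Set.indicator_of_mem this, hW]
    · have : (z, ζ) ∉ S := h
      rw [Set.indicator_of_notMem h]
      simp [hκ, Set.indicator_of_notMem this]
  calc ∫⁻ z in disc, ‖F (φ z)‖ₑ ^ p * W z
      ≤ ∫⁻ z in disc, (∫⁻ ζ in disc, κ z ζ * H ζ) * W z := by
        refine setLIntegral_mono' measurableSet_disc fun z hz => ?_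
        gcongr
        exact step1 z hz
    _ = ∫⁻ z in disc, ∫⁻ ζ in disc, κ z ζ * H ζ * W z := by
        refine lintegral_congr fun z => ?_
        rw [lintegral_mul_const]
        exact (hκm.comp measurable_prodMk_left).mul hHm
    _ = ∫⁻ ζ in disc, ∫⁻ z in disc, κ z ζ * H ζ * W z := by
        refine lintegral_lintegral_swap (Measurable.aemeasurable ?_)
        exact (hκm.mul (hHm.comp measurable_snd)).mul (hWm.comp measurable_fst)
    _ = ∫⁻ ζ in disc, H ζ * ∫⁻ z in disc, κ z ζ * W z := by
        refine lintegral_congr fun ζ => ?_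
        rw [← lintegral_const_mul]
        · exact lintegral_congr fun z => by ring
        · exact (hκm.comp measurable_prodMk_right).mul hWm
    _ ≤ ∫⁻ ζ in disc, compConst p * (‖F ζ‖ₑ ^ p * weight p 0 ζ) := by
        refine setLIntegral_mono' measurableSet_disc fun ζ hζ => ?_
        refine (mul_le_mul_right (step2 ζ hζ) (H ζ)).trans ?_
        have hζ1 := norm_lt_one hζ
        have hd : 0 < 1 - ‖ζ‖ := by linarith
        have hd2 := one_sub_norm_sq_pos hζ
        rw [hH, weight_zero hζ, compConst, mul_assoc, mul_left_comm (_ : ℝ≥0∞) (‖F ζ‖ₑ ^ p)]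
        refine mul_le_mul' le_rfl ?_
        change _ ≤ ENNReal.ofReal (324 * 4 ^ (p - 1)) * _
        rw [← ENNReal.ofReal_mul (by positivity), ← ENNReal.ofReal_mul (by positivity)]
        refine ENNReal.ofReal_le_ofReal ?_
        rw [Real.mul_rpow (by norm_num) hd.le]
        -- Here 324 = 9 · 36: the Whitney average contributes 9 and the preimage estimate 36; the
        -- powers of π(1 - |ζ|)² cancel.
        calc 9 / (Real.pi * (1 - ‖ζ‖) ^ 2) *
              (36 * Real.pi * (1 - ‖ζ‖) ^ 2 * (4 ^ (p - 1) * (1 - ‖ζ‖) ^ (p - 1)))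
            = 324 * 4 ^ (p - 1) * (1 - ‖ζ‖) ^ (p - 1) := by field_simp; ring
          _ ≤ _ := by
            have : 0 ≤ p - 1 := by linarith
            have : 1 - ‖ζ‖ ≤ 1 - ‖ζ‖ ^ 2 := by nlinarith [norm_nonneg ζ]
            gcongr
    _ = _ := by rw [lintegral_const_mul' _ _ ENNReal.coe_ne_top]

/-! ### Conformal invariance and reduction to the origin. -/

theorem image_mobius {a : ℂ} (ha : a ∈ disc) : mobius a '' disc = disc := by
  refine (mapsTo_mobius ha).image_subset.antisymm fun z hz => ?_
  exact ⟨mobius a z, mobius_mem_disc ha hz, mobius_mobius ha hz⟩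

theorem lintegral_mobius {a : ℂ} (ha : a ∈ disc) (g : ℂ → ℝ≥0∞) :
    ∫⁻ z in disc, ‖deriv (mobius a) z‖ₑ ^ 2 * g (mobius a z) = ∫⁻ z in disc, g z := by
  rw [← lintegral_image_holomorphic measurableSet_disc
    (fun z hz => (hasDerivAt_mobius ha hz).differentiableAt) (injOn_mobius ha), image_mobius ha]

/-- Conformal invariance of the integrals. -/
theorem osc_comp_mobius {f : ℂ → ℂ} (hf : DifferentiableOn ℂ f disc) {p : ℝ} (hp : 0 ≤ p) {a : ℂ}
    (ha : a ∈ disc) :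
    osc p (fun z => ‖deriv (f ∘ mobius a) z‖ₑ) 0 = osc p (fun z => ‖deriv f z‖ₑ) a := by
  rw [osc, osc, ← lintegral_mobius ha fun z => ‖deriv f z‖ₑ ^ p * weight p a z]
  refine setLIntegral_congr_fun measurableSet_disc fun z hz => ?_
  rw [deriv_comp_disc hf (differentiableOn_mobius ha) (mapsTo_mobius ha) hz, enorm_mul,
    ENNReal.mul_rpow_of_nonneg _ _ hp, mul_left_comm, mul_assoc]
  congr 1
  have hz0 := one_sub_norm_sq_pos hz
  have hpos : 0 < ‖deriv (mobius a) z‖ := by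
    have h1 := norm_deriv_mobius_mul ha hz
    have h2 := one_sub_norm_mobius_sq_pos ha hz
    rw [← h1] at h2
    exact pos_of_mul_pos_left h2 hz0.le
  -- The Jacobian takes |φ_a'|² out of |φ_a'|^p; the remaining |φ_a'|^(p-2) turns (1 - |z|²)^(p-2)
  -- into (1 - |φ_a(z)|²)^(p-2).
  rw [weight_zero hz, weight, mobius_mobius ha hz, ← norm_deriv_mobius_mul ha hz, enorm_rpow _ hp,
    ← ofReal_norm, ← ENNReal.ofReal_pow (norm_nonneg _), ← ENNReal.ofReal_mul (by positivity),
    ← ENNReal.ofReal_mul (by positivity), Real.mul_rpow (norm_nonneg _) hz0.le]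
  congr 1
  have e1 : ‖deriv (mobius a) z‖ ^ p =
      ‖deriv (mobius a) z‖ ^ 2 * ‖deriv (mobius a) z‖ ^ (p - 2) := by
    rw [← Real.rpow_natCast, ← Real.rpow_add hpos]
    congr 1; push_cast; ring
  have e2 : (1 - ‖z‖ ^ 2) ^ (p - 1) = (1 - ‖z‖ ^ 2) ^ (p - 2) * (1 - ‖z‖ ^ 2) := by
    rw [← Real.rpow_add_one hz0.ne']; congr 1; ring
  rw [e1, e2]
  ring

/-- Composition with a univalent self-map `φ` of the disc is bounded, with a constant which does
not depend on `φ`. -/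
theorem osc_comp_le {f φ : ℂ → ℂ} (hf : DifferentiableOn ℂ f disc)
    (hφ : DifferentiableOn ℂ φ disc) (hm : Set.MapsTo φ disc disc) (hi : Set.InjOn φ disc)
    {p : ℝ} (hp : 1 ≤ p) {a : ℂ} (ha : a ∈ disc) :
    osc p (fun z => ‖deriv (f ∘ φ) z‖ₑ) a ≤
      compConst p * osc p (fun z => ‖deriv f z‖ₑ) (φ a) := by
  have hp0 : 0 ≤ p := by linarith
  have hb := hm ha
  set g := f ∘ mobius (φ a) with hg
  have hgd : DifferentiableOn ℂ g disc := hf.comp (differentiableOn_mobius hb) (mapsTo_mobius hb)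
  have hcd := differentiableOn_conjMap hφ hm ha
  have hcm := mapsTo_conjMap hm ha
  rw [← osc_comp_mobius (hf.comp hφ hm) hp0 ha, ← osc_comp_mobius hf hp0 hb, ← hg]
  -- The two outer Möbius maps cancel because each is an involution, leaving a self-map that fixes
  -- 0.
  have heq : Set.EqOn ((f ∘ φ) ∘ mobius a) (g ∘ conjMap φ a) disc := fun z hz => by
    simp only [hg, conjMap, Function.comp, mobius_mobius hb (hm (mobius_mem_disc ha hz))]
  refine le_trans (le_of_eq ?_) (lintegral_comp_le (F := deriv g) (hgd.deriv isOpen_disc)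
    (measurable_deriv g) hcd hcm (injOn_conjMap hm ha hi) conjMap_zero hp)
  refine setLIntegral_congr_fun measurableSet_disc fun z hz => ?_
  beta_reduce
  rw [deriv_congr_disc heq hz, deriv_comp_disc hgd hcd hcm hz, enorm_mul,
    ENNReal.mul_rpow_of_nonneg _ _ hp0, mul_assoc]

theorem oscInt_comp_le {f φ : ℂ → ℂ} (hf : DifferentiableOn ℂ f disc)
    (hφ : DifferentiableOn ℂ φ disc) (hm : Set.MapsTo φ disc disc) (hi : Set.InjOn φ disc)
    {p : ℝ} (hp : 1 ≤ p) {a : ℂ} (ha : a ∈ disc) :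
    oscInt p (f ∘ φ) a ≤ compConst p * oscInt p f (φ a) := by
  rw [oscInt_eq (by linarith), oscInt_eq (by linarith), mul_left_comm]
  gcongr
  exact osc_comp_le hf hφ hm hi hp ha

/-! ### Control of the integrals by Dirichlet integrals. -/

/-- The factor `1 - |φ_a(z)|²` of the weight. -/
def mobWeight (a z : ℂ) : ℝ≥0∞ := ENNReal.ofReal (1 - ‖mobius a z‖ ^ 2)

theorem measurable_mobWeight (a : ℂ) : Measurable (mobWeight a) := by
  have := measurable_mobius a
  unfold mobWeight
  fun_prop

theorem mobWeight_le_one (a z : ℂ) : mobWeight a z ≤ 1 := by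
  rw [mobWeight, ← ENNReal.ofReal_one]
  exact ENNReal.ofReal_le_ofReal (by nlinarith [norm_nonneg (mobius a z)])

theorem ofReal_one_sub_norm_sq_ne_zero {z : ℂ} (hz : z ∈ disc) :
    ENNReal.ofReal (1 - ‖z‖ ^ 2) ≠ 0 := by
  simpa using one_sub_norm_sq_pos hz

theorem weight_eq {p : ℝ} {a z : ℂ} (hz : z ∈ disc) :
    weight p a z = ENNReal.ofReal (1 - ‖z‖ ^ 2) ^ (p - 2) * mobWeight a z := by
  have := one_sub_norm_sq_pos hz
  rw [weight, mobWeight, ENNReal.ofReal_rpow_of_pos this, ENNReal.ofReal_mul (by positivity)]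

/-- The area integral of `(1 - |z|²)^(-1/2)`. -/
def discConst : ℝ≥0∞ := ∫⁻ z in disc, ENNReal.ofReal (1 - ‖z‖ ^ 2) ^ (-(1 / 2) : ℝ)

theorem discConst_lt_top : discConst < ∞ := by
  have hint : IntegrableOn (fun r : ℝ => (1 - r) ^ (-(1 / 2) : ℝ)) (Set.Ioc 0 1) := by
    have h := (intervalIntegral.intervalIntegrable_rpow' (a := 0) (b := 1) (r := -(1 / 2))
      (by norm_num)).comp_sub_left 1
    rw [sub_zero, sub_self] at h
    exact (intervalIntegrable_iff_integrableOn_Ioc_of_le zero_le_one).1 h.symm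
  have hlt := hint.lintegral_lt_top
  have hu : Measurable (disc.indicator fun z => ENNReal.ofReal (1 - ‖z‖ ^ 2) ^ (-(1 / 2) : ℝ)) :=
    Measurable.indicator (by fun_prop) measurableSet_disc
  rw [discConst, ← lintegral_indicator measurableSet_disc, lintegral_polar hu 0]
  have key : ∀ r ∈ Set.Ioi (0 : ℝ), ENNReal.ofReal r * ∫⁻ θ in Set.Ioc (-Real.pi) Real.pi,
      disc.indicator (fun z => ENNReal.ofReal (1 - ‖z‖ ^ 2) ^ (-(1 / 2) : ℝ)) (circleMap 0 r θ) ≤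
      (Set.Ioo 0 1).indicator (fun r : ℝ => ENNReal.ofReal ((1 - r) ^ (-(1 / 2) : ℝ)) *
        ENNReal.ofReal (2 * Real.pi)) r := by
    intro r hr
    have hr0 : (0 : ℝ) < r := hr
    have hn : ∀ θ, ‖circleMap 0 r θ‖ = r := fun θ => by simp [abs_of_pos hr0]
    by_cases h : r < 1
    · rw [Set.indicator_of_mem (Set.mem_Ioo.2 ⟨hr0, h⟩)]
      have hmem : ∀ θ, circleMap 0 r θ ∈ disc := fun θ => by
        rw [mem_ball_zero_iff, hn]; exact h
      rw [lintegral_congr fun θ => Set.indicator_of_mem (hmem θ) _]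
      simp only [hn, lintegral_const, Measure.restrict_apply_univ, Real.volume_Ioc]
      have e : Real.pi - -Real.pi = 2 * Real.pi := by ring
      rw [e, ENNReal.ofReal_rpow_of_pos (by nlinarith)]
      refine (mul_le_of_le_one_left' (by simpa using h.le)).trans ?_
      refine mul_le_mul' (ENNReal.ofReal_le_ofReal ?_) le_rfl
      exact Real.rpow_le_rpow_of_nonpos (by linarith) (by nlinarith) (by norm_num)
    · have hmem : ∀ θ, circleMap 0 r θ ∉ disc := fun θ => by
        rw [mem_ball_zero_iff, hn]; exact h
      rw [lintegral_congr fun θ => Set.indicator_of_notMem (hmem θ) _]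
      simp
  refine (setLIntegral_mono' measurableSet_Ioi key).trans_lt ?_
  refine (setLIntegral_le_lintegral _ _).trans_lt ?_
  rw [lintegral_indicator measurableSet_Ioo, lintegral_mul_const' _ _ ENNReal.ofReal_ne_top,
    setLIntegral_congr Ioo_ae_eq_Ioc]
  exact ENNReal.mul_lt_top hlt ENNReal.ofReal_lt_top

/-- The measure (1 - |z|²)^(-2) dA is Möbius invariant, so a may be moved to 0. The exponent 3/2
exceeds 1, which makes the resulting integral of (1 - |z|²)^(-1/2) converge. -/
theorem lintegral_mobWeight {a : ℂ} (ha : a ∈ disc) :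
    ∫⁻ z in disc, ENNReal.ofReal (1 - ‖z‖ ^ 2) ^ (-2 : ℝ) * mobWeight a z ^ (3 / 2 : ℝ) =
      discConst := by
  rw [discConst, ← lintegral_mobius ha fun z =>
    ENNReal.ofReal (1 - ‖z‖ ^ 2) ^ (-2 : ℝ) * mobWeight a z ^ (3 / 2 : ℝ)]
  refine setLIntegral_congr_fun measurableSet_disc fun z hz => ?_
  have hz0 := ofReal_one_sub_norm_sq_ne_zero hz
  have hm := ofReal_one_sub_norm_sq_ne_zero (mobius_mem_disc ha hz)
  rw [mobWeight, mobius_mobius ha hz]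
  have e := congrArg ENNReal.ofReal (norm_deriv_mobius_mul ha hz)
  rw [ENNReal.ofReal_mul (norm_nonneg _), ofReal_norm] at e
  rw [← e] at hm ⊢
  set s := ENNReal.ofReal (1 - ‖z‖ ^ 2)
  have hst : s ≠ ∞ := ENNReal.ofReal_ne_top
  have hd0 : ‖deriv (mobius a) z‖ₑ ≠ 0 := left_ne_zero_of_mul hm
  have hdt : ‖deriv (mobius a) z‖ₑ ≠ ∞ := enorm_ne_top
  set D := ‖deriv (mobius a) z‖ₑ
  rw [ENNReal.mul_rpow_of_ne_top hdt hst, ← ENNReal.rpow_natCast, ← mul_assoc, ← mul_assoc,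
    ← ENNReal.rpow_add _ _ hd0 hdt, mul_assoc, ← ENNReal.rpow_add _ _ hz0 hst]
  norm_num

/-- Control of the integrals by a weighted Dirichlet integral. -/
theorem osc_le_dirichlet {p : ℝ} (hp : 1 ≤ p) {u : ℂ → ℝ≥0∞} (hu : Measurable u) {M : ℝ≥0∞}
    (hM : ∀ z ∈ disc, u z * ENNReal.ofReal (1 - ‖z‖ ^ 2) ≤ M) (hMt : M ≠ ∞) {a : ℂ}
    (ha : a ∈ disc) :
    osc p u a ≤ ((1 + M) ^ p + (1 + discConst)) *
      (∫⁻ z in disc, u z ^ 2 * mobWeight a z ^ (1 / (2 * p))) ^ (min (p / 2) 1) := by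
  have hmw := measurable_mobWeight a
  have hk := mobWeight_le_one a
  rcases le_or_gt 2 p with h2 | h2
  -- For p ≥ 2 the surplus power of u is paired with the weight and bounded by M^(p-2).
  · rw [min_eq_right (by linarith), ENNReal.rpow_one]
    have h1 : M ^ (p - 2) ≤ (1 + M) ^ p + (1 + discConst) := by
      calc M ^ (p - 2) ≤ (1 + M) ^ (p - 2) :=
            ENNReal.rpow_le_rpow le_add_self (by linarith)
        _ ≤ (1 + M) ^ p := ENNReal.rpow_le_rpow_of_exponent_le le_self_add (by linarith)
        _ ≤ _ := le_self_add
    refine le_trans ?_ (mul_le_mul' h1 le_rfl)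
    rw [← lintegral_const_mul' _ _ (ENNReal.rpow_ne_top_of_nonneg (by linarith) hMt)]
    refine setLIntegral_mono' measurableSet_disc fun z hz => ?_
    have e : u z ^ p = u z ^ (p - 2) * u z ^ 2 := by
      rw [← ENNReal.rpow_natCast, ← ENNReal.rpow_add_of_nonneg _ _ (by linarith) (by norm_num)]
      congr 1; push_cast; ring
    rw [weight_eq hz, e]
    calc u z ^ (p - 2) * u z ^ 2 * (ENNReal.ofReal (1 - ‖z‖ ^ 2) ^ (p - 2) * mobWeight a z)
        = (u z * ENNReal.ofReal (1 - ‖z‖ ^ 2)) ^ (p - 2) * (u z ^ 2 * mobWeight a z) := by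
          rw [ENNReal.mul_rpow_of_nonneg _ _ (by linarith)]; ring
      _ ≤ M ^ (p - 2) * (u z ^ 2 * mobWeight a z ^ (1 / (2 * p))) := by
          refine mul_le_mul' (ENNReal.rpow_le_rpow (hM z hz) (by linarith)) (mul_le_mul' le_rfl ?_)
          refine (ENNReal.rpow_one _).symm.le.trans
            (ENNReal.rpow_le_rpow_of_exponent_ge (hk z) ?_)
          rw [div_le_one (by linarith)]; linarith
  · rw [min_eq_left (by linarith)]
    have h1 : discConst ^ (1 - p / 2) ≤ (1 + M) ^ p + (1 + discConst) := by
      calc discConst ^ (1 - p / 2) ≤ (1 + discConst) ^ (1 - p / 2) :=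
            ENNReal.rpow_le_rpow le_add_self (by linarith)
        _ ≤ (1 + discConst) ^ (1 : ℝ) :=
            ENNReal.rpow_le_rpow_of_exponent_le le_self_add (by linarith)
        _ = 1 + discConst := ENNReal.rpow_one _
        _ ≤ _ := le_add_self
    refine le_trans ?_ (mul_le_mul' h1 le_rfl)
    -- For p < 2, Hölder with weights p/2 and 1 - p/2 separates u² from the invariant integral.
    rw [mul_comm, ← lintegral_mobWeight ha]
    refine le_trans ?_ (ENNReal.lintegral_mul_norm_pow_le (by fun_prop) (by fun_prop)
      (by linarith) (by linarith) (by ring))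
    refine setLIntegral_mono' measurableSet_disc fun z hz => ?_
    rw [weight_eq hz]
    have hq : 0 ≤ 1 - p / 2 := by linarith
    have hp2 : 0 ≤ p / 2 := by linarith
    rw [ENNReal.mul_rpow_of_nonneg _ _ hp2, ENNReal.mul_rpow_of_nonneg _ _ hq,
      ← ENNReal.rpow_natCast, ← ENNReal.rpow_mul, ← ENNReal.rpow_mul, ← ENNReal.rpow_mul,
      ← ENNReal.rpow_mul]
    have e1 : ((2 : ℕ) : ℝ) * (p / 2) = p := by push_cast; ring
    have e2 : 1 / (2 * p) * (p / 2) = 1 / 4 := by field_simp; norm_num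
    have e3 : (-2 : ℝ) * (1 - p / 2) = p - 2 := by ring
    rw [e1, e2, e3]
    -- The exponents 1/4 and (3/2)(1 - p/2) sum to at most 1 exactly when p ≥ 1. At p = 1 nothing is
    -- lost.
    calc u z ^ p * (ENNReal.ofReal (1 - ‖z‖ ^ 2) ^ (p - 2) * mobWeight a z)
        ≤ u z ^ p * (ENNReal.ofReal (1 - ‖z‖ ^ 2) ^ (p - 2) *
          (mobWeight a z ^ (1 / 4 : ℝ) * mobWeight a z ^ (3 / 2 * (1 - p / 2)))) := by
          refine mul_le_mul' le_rfl (mul_le_mul' le_rfl ?_)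
          rw [← ENNReal.rpow_add_of_nonneg _ _ (by norm_num) (by linarith)]
          exact (ENNReal.rpow_one _).symm.le.trans
            (ENNReal.rpow_le_rpow_of_exponent_ge (hk z) (by linarith))
      _ = _ := by ring

/-! ### Boundary behaviour and comparison of base points. -/

/-- The filter of points of the disc tending to the boundary. -/
abbrev bdry : Filter ℂ := comap (fun a : ℂ => ‖a‖) (𝓝[<] (1 : ℝ))

theorem eventually_bdry_mem_disc : ∀ᶠ a in bdry, a ∈ disc := by
  have h : ∀ᶠ r in 𝓝[<] (1 : ℝ), r < 1 := eventually_mem_nhdsWithin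
  exact (h.comap _).mono fun a ha => by simpa using ha

theorem tendsto_norm_bdry : Tendsto (fun a : ℂ => ‖a‖) bdry (𝓝 1) :=
  tendsto_comap.mono_right nhdsWithin_le_nhds

theorem tendsto_mobWeight {z : ℂ} (hz : z ∈ disc) :
    Tendsto (fun a => mobWeight a z) bdry (𝓝 0) := by
  have hz1 := norm_lt_one hz
  have h1 : Tendsto (fun a : ℂ => ENNReal.ofReal ((1 - ‖a‖ ^ 2) / (1 - ‖z‖) ^ 2)) bdry (𝓝 0) := by
    have := ENNReal.tendsto_ofReal
      (((tendsto_norm_bdry.pow 2).const_sub 1).div_const ((1 - ‖z‖) ^ 2))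
    simpa using this
  refine tendsto_of_tendsto_of_tendsto_of_le_of_le' tendsto_const_nhds h1
    (Eventually.of_forall fun _ => zero_le) ?_
  filter_upwards [eventually_bdry_mem_disc] with a ha
  refine ENNReal.ofReal_le_ofReal ?_
  rw [one_sub_norm_mobius_sq ha hz]
  have h2 : 1 - ‖z‖ ≤ ‖1 - (starRingEnd ℂ) a * z‖ := by
    have h := one_sub_norm_le (a := z) ha
    rwa [← RCLike.norm_conj (1 - _), map_sub, map_one, map_mul, RCLike.conj_conj, mul_comm] at h
  have h3 : 0 < 1 - ‖z‖ := by linarith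
  have h4 := (one_sub_norm_sq_pos ha).le
  have h5 : (1 - ‖a‖ ^ 2) * (1 - ‖z‖ ^ 2) ≤ 1 - ‖a‖ ^ 2 := by nlinarith [sq_nonneg ‖z‖]
  gcongr

/-- The power of 1 - |φ_a|² kept in `osc_le_dirichlet` tends to 0 pointwise as |a| tends to 1, and
u² dominates. -/
theorem tendsto_osc_bdry {p : ℝ} (hp : 1 ≤ p) {u : ℂ → ℝ≥0∞} (hu : Measurable u) {M : ℝ≥0∞}
    (hM : ∀ z ∈ disc, u z * ENNReal.ofReal (1 - ‖z‖ ^ 2) ≤ M) (hMt : M ≠ ∞)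
    (h2 : ∫⁻ z in disc, u z ^ 2 ≠ ∞) : Tendsto (osc p u) bdry (𝓝 0) := by
  have hp0 : 0 < p := by linarith
  have hut : ∀ z ∈ disc, u z ≠ ∞ := fun z hz h => by
    have := hM z hz
    rw [h, ENNReal.top_mul (ofReal_one_sub_norm_sq_ne_zero hz), top_le_iff] at this
    exact hMt this
  have hlim : Tendsto (fun a => ∫⁻ z in disc, u z ^ 2 * mobWeight a z ^ (1 / (2 * p))) bdry
      (𝓝 (∫⁻ z in disc, 0)) := by
    refine tendsto_lintegral_filter_of_dominated_convergence (fun z => u z ^ 2) ?_ ?_ h2 ?_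
    · refine Eventually.of_forall fun a => ?_
      have := measurable_mobWeight a
      fun_prop
    · refine Eventually.of_forall fun a => ae_of_all _ fun z => ?_
      exact mul_le_of_le_one_right' (ENNReal.rpow_le_one (mobWeight_le_one a z) (by positivity))
    · refine (ae_restrict_iff' measurableSet_disc).2 (ae_of_all _ fun z hz => ?_)
      have h1 := ENNReal.Tendsto.const_mul (a := u z ^ 2)
        ((ENNReal.continuous_rpow_const (y := 1 / (2 * p))).tendsto 0 |>.comp (tendsto_mobWeight hz))
        (Or.inr (ENNReal.pow_ne_top (hut z hz)))
      rw [ENNReal.zero_rpow_of_pos (by positivity), mul_zero] at h1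
      exact h1
  rw [lintegral_zero] at hlim
  have hθ : 0 < min (p / 2) 1 := lt_min (by linarith) one_pos
  have h3 := ENNReal.Tendsto.const_mul (a := (1 + M) ^ p + (1 + discConst))
    ((ENNReal.continuous_rpow_const (y := min (p / 2) 1)).tendsto 0 |>.comp hlim)
    (Or.inr (by
      have := discConst_lt_top.ne
      have := ENNReal.rpow_ne_top_of_nonneg hp0.le (ENNReal.add_ne_top.2 ⟨ENNReal.one_ne_top, hMt⟩)
      finiteness))
  rw [ENNReal.zero_rpow_of_pos hθ, mul_zero] at h3
  refine tendsto_of_tendsto_of_tendsto_of_le_of_le' tendsto_const_nhds h3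
    (Eventually.of_forall fun _ => zero_le) ?_
  filter_upwards [eventually_bdry_mem_disc] with a ha
  exact osc_le_dirichlet hp hu hM hMt ha

theorem osc_le_of_le_add {p : ℝ} (hp : 1 ≤ p) {u v w : ℂ → ℝ≥0∞} (hv : Measurable v)
    (h : ∀ z ∈ disc, u z ≤ v z + w z) (a : ℂ) :
    osc p u a ≤ 2 ^ (p - 1) * (osc p v a + osc p w a) := by
  have hw := measurable_weight p a
  rw [osc, osc, osc, ← lintegral_add_left (by fun_prop),
    ← lintegral_const_mul' _ _ (ENNReal.rpow_ne_top_of_nonneg (by linarith) (by simp))]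
  refine setLIntegral_mono' measurableSet_disc fun z hz => ?_
  calc u z ^ p * weight p a z ≤ (2 ^ (p - 1) * (v z ^ p + w z ^ p)) * weight p a z := by
        refine mul_le_mul' ?_ le_rfl
        exact (ENNReal.rpow_le_rpow (h z hz) (by linarith)).trans
          (ENNReal.rpow_add_le_mul_rpow_add_rpow _ _ hp)
    _ = _ := by ring

theorem deriv_sub_disc {f g : ℂ → ℂ} (hf : DifferentiableOn ℂ f disc)
    (hg : DifferentiableOn ℂ g disc) {z : ℂ} (hz : z ∈ disc) :
    deriv (f - g) z = deriv f z - deriv g z :=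
  deriv_sub (differentiableAt_of_disc hf hz) (differentiableAt_of_disc hg hz)

theorem oscInt_le_of_le_add {p : ℝ} (hp : 1 ≤ p) {f g h : ℂ → ℂ}
    (H : ∀ z ∈ disc, ‖deriv f z‖ₑ ≤ ‖deriv g z‖ₑ + ‖deriv h z‖ₑ) (a : ℂ) :
    oscInt p f a ≤ 2 ^ (p - 1) * (oscInt p g a + oscInt p h a) := by
  have hp0 : 0 ≤ p := by linarith
  rw [oscInt_eq hp0, oscInt_eq hp0, oscInt_eq hp0, ← mul_add, mul_left_comm]
  gcongr
  exact osc_le_of_le_add hp (measurable_deriv g).enorm H a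

theorem oscInt_sub_le {p : ℝ} (hp : 1 ≤ p) {f g : ℂ → ℂ} (hf : DifferentiableOn ℂ f disc)
    (hg : DifferentiableOn ℂ g disc) (a : ℂ) :
    oscInt p (f - g) a ≤ 2 ^ (p - 1) * (oscInt p f a + oscInt p g a) :=
  oscInt_le_of_le_add hp (fun z hz => by rw [deriv_sub_disc hf hg hz]; exact enorm_sub_le) a

/-- On each disc |a| ≤ R < 1 this controls all base points by the origin; `oscInt_zero_le` is the
reverse comparison. -/
theorem oscInt_le_zero {p : ℝ} (hp : 1 ≤ p) (f : ℂ → ℂ) {a : ℂ} (ha : a ∈ disc) :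
    oscInt p f a ≤ ENNReal.ofReal (2 / (1 - ‖a‖)) * oscInt p f 0 := by
  have ha1 := norm_lt_one ha
  have hd : 0 < 1 - ‖a‖ := by linarith
  have hp0 : 0 ≤ p := by linarith
  rw [oscInt_eq hp0, oscInt_eq hp0, mul_left_comm]
  refine mul_le_mul' le_rfl ?_
  rw [osc, osc, ← lintegral_const_mul' _ _ ENNReal.ofReal_ne_top]
  refine setLIntegral_mono' measurableSet_disc fun z hz => ?_
  rw [mul_left_comm]
  refine mul_le_mul' le_rfl ?_
  have hz0 := one_sub_norm_sq_pos hz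
  rw [weight, weight, ← ENNReal.ofReal_mul (by positivity), norm_mobius_zero_left, mul_left_comm]
  refine ENNReal.ofReal_le_ofReal (mul_le_mul_of_nonneg_left ?_ (by positivity))
  rw [one_sub_norm_mobius_sq ha hz, div_mul_eq_mul_div,
    div_le_div_iff₀ (pow_pos (mobius_denom_norm_pos ha hz) 2) hd]
  have h1 : (1 - ‖a‖) ^ 2 ≤ ‖1 - (starRingEnd ℂ) a * z‖ ^ 2 := by
    have := one_sub_norm_le (a := a) hz
    gcongr
  calc (1 - ‖a‖ ^ 2) * (1 - ‖z‖ ^ 2) * (1 - ‖a‖)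
      = (1 + ‖a‖) * (1 - ‖z‖ ^ 2) * (1 - ‖a‖) ^ 2 := by ring
    _ ≤ 2 * (1 - ‖z‖ ^ 2) * ‖1 - (starRingEnd ℂ) a * z‖ ^ 2 := by
        gcongr
        linarith

theorem oscInt_zero_le {p : ℝ} (hp : 1 ≤ p) (f : ℂ → ℂ) {b : ℂ} (hb : b ∈ disc) :
    oscInt p f 0 ≤ ENNReal.ofReal (4 / (1 - ‖b‖ ^ 2)) * oscInt p f b := by
  have hd := one_sub_norm_sq_pos hb
  have hp0 : 0 ≤ p := by linarith
  rw [oscInt_eq hp0, oscInt_eq hp0, mul_left_comm]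
  refine mul_le_mul' le_rfl ?_
  rw [osc, osc, ← lintegral_const_mul' _ _ ENNReal.ofReal_ne_top]
  refine setLIntegral_mono' measurableSet_disc fun z hz => ?_
  rw [mul_left_comm]
  refine mul_le_mul' le_rfl ?_
  have hz0 := one_sub_norm_sq_pos hz
  rw [weight, weight, ← ENNReal.ofReal_mul (by positivity), norm_mobius_zero_left, mul_left_comm]
  refine ENNReal.ofReal_le_ofReal (mul_le_mul_of_nonneg_left ?_ (by positivity))
  have h0 := mobius_denom_norm_pos hb hz
  have h1 : ‖1 - (starRingEnd ℂ) b * z‖ ≤ 2 := by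
    refine (norm_sub_le _ _).trans ?_
    rw [norm_one, norm_mul, RCLike.norm_conj]
    have := mul_le_mul (norm_lt_one hb).le (norm_lt_one hz).le (norm_nonneg z) zero_le_one
    linarith
  rw [one_sub_norm_mobius_sq hb hz, div_mul_div_comm, le_div_iff₀ (by positivity)]
  have h2 : ‖1 - (starRingEnd ℂ) b * z‖ ^ 2 ≤ 2 ^ 2 := by gcongr
  have h3 := mul_le_mul_of_nonneg_left h2 (mul_pos hd hz0).le
  linarith

theorem tendsto_bdry_iff {g : ℂ → ℝ≥0∞} :
    Tendsto g bdry (𝓝 0) ↔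
      ∀ ε > 0, ∃ ρ : ℝ, 0 ≤ ρ ∧ ρ < 1 ∧ ∀ a ∈ disc, ρ < ‖a‖ → g a ≤ ε := by
  rw [ENNReal.tendsto_nhds_zero]
  refine forall₂_congr fun ε _ => ?_
  rw [Filter.eventually_comap, Filter.Eventually, mem_nhdsLT_iff_exists_Ioo_subset]
  constructor
  · rintro ⟨l, hl, h⟩
    refine ⟨max l 0, le_max_right _ _, max_lt hl one_pos, fun a ha hla => ?_⟩
    exact h ⟨(le_max_left _ _).trans_lt hla, norm_lt_one ha⟩ a rfl
  · rintro ⟨ρ, _, hρ, h⟩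
    refine ⟨ρ, hρ, fun r hr a ha => ?_⟩
    exact h a (by simpa [ha] using hr.2) (by simpa [ha] using hr.1)

theorem oscInt_zero_lt_top {p : ℝ} (hp : 1 ≤ p) {f : ℂ → ℂ} (hf : f ∈ VMOA p) :
    oscInt p f 0 < ∞ := by
  obtain ⟨ρ, hρ0, hρ1, h⟩ := tendsto_bdry_iff.1 hf.2 1 one_pos
  set b : ℂ := (((1 + ρ) / 2 : ℝ) : ℂ) with hb
  have hbn : ‖b‖ = (1 + ρ) / 2 := by rw [hb, Complex.norm_real, Real.norm_of_nonneg (by linarith)]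
  have hbd : b ∈ disc := by rw [mem_ball_zero_iff, hbn]; linarith
  refine (oscInt_zero_le hp f hbd).trans_lt (ENNReal.mul_lt_top ENNReal.ofReal_lt_top ?_)
  exact (h b hbd (by rw [hbn]; linarith)).trans_lt ENNReal.one_lt_top

theorem vmoa_subset_bmoa {p : ℝ} (hp : 1 ≤ p) : VMOA p ⊆ BMOA p := by
  intro f hf
  refine ⟨hf.1, ?_⟩
  obtain ⟨ρ, hρ0, hρ1, h⟩ := tendsto_bdry_iff.1 hf.2 1 one_pos
  have h0 := oscInt_zero_lt_top hp hf
  have hle : ⨆ a ∈ disc, oscInt p f a ≤ max 1 (ENNReal.ofReal (2 / (1 - ρ)) * oscInt p f 0) := by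
    refine iSup₂_le fun a ha => ?_
    by_cases hρ : ρ < ‖a‖
    · exact (h a ha hρ).trans (le_max_left _ _)
    · refine (oscInt_le_zero hp f ha).trans (le_trans ?_ (le_max_right _ _))
      refine mul_le_mul' (ENNReal.ofReal_le_ofReal ?_) le_rfl
      push Not at hρ
      have : 0 < 1 - ρ := by linarith
      gcongr
  exact hle.trans_lt (max_lt ENNReal.one_lt_top (ENNReal.mul_lt_top ENNReal.ofReal_lt_top h0))

/-! ### Approximation by dilations. -/

/-- The dilation `z ↦ r z`. -/
def dil (r : ℝ) : ℂ → ℂ := fun z => (r : ℂ) * z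

theorem differentiable_dil (r : ℝ) : Differentiable ℂ (dil r) := by
  unfold dil
  fun_prop

theorem deriv_dil (r : ℝ) (z : ℂ) : deriv (dil r) z = r := by
  have h := ((hasDerivAt_id z).const_mul (r : ℂ)).deriv
  rwa [mul_one] at h

theorem norm_dil {r : ℝ} (hr : 0 < r) (z : ℂ) : ‖dil r z‖ = r * ‖z‖ := by
  rw [dil, norm_mul, Complex.norm_real, Real.norm_of_nonneg hr.le]

theorem mapsTo_dil {r : ℝ} (hr : r ∈ Set.Ioo (0 : ℝ) 1) : Set.MapsTo (dil r) disc disc := by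
  intro z hz
  rw [mem_ball_zero_iff, norm_dil hr.1]
  have := norm_lt_one hz
  nlinarith [hr.1, hr.2, norm_nonneg z]

theorem injective_dil {r : ℝ} (hr : 0 < r) : Function.Injective (dil r) :=
  mul_right_injective₀ (by exact_mod_cast hr.ne')

theorem deriv_comp_dil {f : ℂ → ℂ} (hf : DifferentiableOn ℂ f disc) {r : ℝ}
    (hr : r ∈ Set.Ioo (0 : ℝ) 1) {z : ℂ} (hz : z ∈ disc) :
    deriv (f ∘ dil r) z = deriv f (dil r z) * r := by
  rw [deriv_comp_disc hf (differentiable_dil r).differentiableOn (mapsTo_dil hr) hz, deriv_dil]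

theorem differentiableOn_comp_dil {f : ℂ → ℂ} (hf : DifferentiableOn ℂ f disc) {r : ℝ}
    (hr : r ∈ Set.Ioo (0 : ℝ) 1) : DifferentiableOn ℂ (f ∘ dil r) disc :=
  hf.comp (differentiable_dil r).differentiableOn (mapsTo_dil hr)

theorem continuousOn_deriv {f : ℂ → ℂ} (hf : DifferentiableOn ℂ f disc) :
    ContinuousOn (deriv f) disc := (hf.deriv isOpen_disc).continuousOn

theorem exists_norm_deriv_le {f : ℂ → ℂ} (hf : DifferentiableOn ℂ f disc) {R : ℝ} (hR : R < 1) :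
    ∃ L : ℝ, 0 ≤ L ∧ ∀ z, ‖z‖ ≤ R → ‖deriv f z‖ ≤ L := by
  obtain ⟨L, hL⟩ := (isCompact_closedBall (0 : ℂ) R).exists_bound_of_continuousOn
    ((continuousOn_deriv hf).mono (Metric.closedBall_subset_ball hR))
  refine ⟨max L 0, le_max_right _ _, fun z hz => (hL z ?_).trans (le_max_left _ _)⟩
  simpa using hz

theorem exists_norm_deriv_comp_dil_le {f : ℂ → ℂ} (hf : DifferentiableOn ℂ f disc) {r : ℝ}
    (hr : r ∈ Set.Ioo (0 : ℝ) 1) :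
    ∃ L : ℝ, 0 ≤ L ∧ ∀ z ∈ disc, ‖deriv (f ∘ dil r) z‖ ≤ L := by
  obtain ⟨L, hL0, hL⟩ := exists_norm_deriv_le hf hr.2
  refine ⟨L, hL0, fun z hz => ?_⟩
  have h1 := hL (dil r z) (by
    rw [norm_dil hr.1]
    exact mul_le_of_le_one_right hr.1.le (norm_lt_one hz).le)
  rw [deriv_comp_dil hf hr hz, norm_mul, Complex.norm_real, Real.norm_of_nonneg hr.1.le]
  exact (mul_le_of_le_one_right (norm_nonneg _) hr.2.le).trans h1

/-- The part of the disc outside the closed ball of radius `R`. -/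
def outerRing (R : ℝ) : Set ℂ := disc ∩ {z | R < ‖z‖}

theorem measurableSet_ring (R : ℝ) : MeasurableSet (outerRing R) :=
  measurableSet_disc.inter (measurableSet_lt measurable_const measurable_norm)

theorem weight_zero_mono {p : ℝ} (hp : 1 ≤ p) {z w : ℂ} (hz : z ∈ disc) (hwz : ‖w‖ ≤ ‖z‖) :
    weight p 0 z ≤ weight p 0 w := by
  have hw : w ∈ disc := by
    rw [mem_ball_zero_iff]; exact hwz.trans_lt (norm_lt_one hz)
  rw [weight_zero hz, weight_zero hw]
  have := one_sub_norm_sq_pos hz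
  have : 0 ≤ p - 1 := by linarith
  gcongr

theorem weight_zero_le_one {p : ℝ} (hp : 1 ≤ p) {z : ℂ} (hz : z ∈ disc) : weight p 0 z ≤ 1 := by
  rw [weight_zero hz, ← ENNReal.ofReal_one]
  exact ENNReal.ofReal_le_ofReal (Real.rpow_le_one (one_sub_norm_sq_pos hz).le
    (by nlinarith [norm_nonneg z]) (by linarith))

/-- Change of variables costs r^(-2) ≤ 4, and the weight at the origin decreases in |z|. The tails
of all dilations with r > 1/2 are thus controlled by the tail of f. -/
theorem lintegral_ring_dil_le {f : ℂ → ℂ} (hf : DifferentiableOn ℂ f disc) {p : ℝ} (hp : 1 ≤ p)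
    {r R : ℝ} (hr : r ∈ Set.Ioo (1 / 2 : ℝ) 1) :
    ∫⁻ z in outerRing R, ‖deriv (f ∘ dil r) z‖ₑ ^ p * weight p 0 z ≤
      4 * ∫⁻ z in outerRing (r * R), ‖deriv f z‖ₑ ^ p * weight p 0 z := by
  have hr0 : 0 < r := by linarith [hr.1]
  have hr' : r ∈ Set.Ioo (0 : ℝ) 1 := ⟨hr0, hr.2⟩
  have h1 := lintegral_image_holomorphic (measurableSet_ring R)
    (fun z _ => (differentiable_dil r) z) (injective_dil hr0).injOn
    fun z => ‖deriv f z‖ₑ ^ p * weight p 0 z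
  have h2 : dil r '' outerRing R ⊆ outerRing (r * R) := by
    rintro _ ⟨z, hz, rfl⟩
    refine ⟨mapsTo_dil hr' hz.1, ?_⟩
    change r * R < ‖dil r z‖
    rw [norm_dil hr0]
    exact mul_lt_mul_of_pos_left hz.2 hr0
  refine le_trans ?_ (mul_le_mul' le_rfl (lintegral_mono_set h2))
  rw [h1, ← lintegral_const_mul' _ _ (by simp)]
  refine setLIntegral_mono' (measurableSet_ring R) fun z hz => ?_
  rw [deriv_dil, ← mul_assoc]
  have h3 : (1 : ℝ≥0∞) ≤ 4 * ‖(r : ℂ)‖ₑ ^ 2 := by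
    rw [← ofReal_norm, Complex.norm_real, Real.norm_of_nonneg hr0.le, ← ENNReal.ofReal_pow hr0.le]
    rw [show (4 : ℝ≥0∞) = ENNReal.ofReal 4 by simp, ← ENNReal.ofReal_mul (by norm_num),
      ← ENNReal.ofReal_one]
    exact ENNReal.ofReal_le_ofReal (by nlinarith [hr.1])
  refine le_trans ?_ (mul_le_mul' h3 le_rfl)
  rw [one_mul]
  refine mul_le_mul' (ENNReal.rpow_le_rpow ?_ (by linarith)) ?_
  · rw [deriv_comp_dil hf hr' hz.1, enorm_mul]
    refine mul_le_of_le_one_right' ?_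
    rw [← ofReal_norm, Complex.norm_real, Real.norm_of_nonneg hr0.le]
    simpa using hr.2.le
  · refine weight_zero_mono hp hz.1 ?_
    rw [norm_dil hr0]
    exact mul_le_of_le_one_left (norm_nonneg _) hr.2.le

theorem tendsto_lintegral_ring {F : ℂ → ℝ≥0∞} (hF : Measurable F) (hfin : ∫⁻ z in disc, F z ≠ ∞) :
    Tendsto (fun R => ∫⁻ z in outerRing R, F z) (𝓝[<] (1 : ℝ)) (𝓝 0) := by
  have h : ∀ R, ∫⁻ z in outerRing R, F z = ∫⁻ z in disc, {z | R < ‖z‖}.indicator F z := fun R => by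
    rw [lintegral_indicator (measurableSet_lt measurable_const measurable_norm),
      Measure.restrict_restrict (measurableSet_lt measurable_const measurable_norm), Set.inter_comm]
    rfl
  simp only [h]
  rw [← lintegral_zero (μ := volume.restrict disc)]
  refine tendsto_lintegral_filter_of_dominated_convergence F ?_ ?_ hfin ?_
  · exact Eventually.of_forall fun R =>
      hF.indicator (measurableSet_lt measurable_const measurable_norm)
  · exact Eventually.of_forall fun R => ae_of_all _ fun z => Set.indicator_le_self _ _ _
  · refine (ae_restrict_iff' measurableSet_disc).2 (ae_of_all _ fun z hz => ?_)
    refine tendsto_const_nhds.congr' ?_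
    filter_upwards [eventually_nhdsWithin_of_eventually_nhds (eventually_gt_nhds (norm_lt_one hz))]
      with R hR
    rw [Set.indicator_of_notMem]
    exact fun h : R < ‖z‖ => lt_asymm h hR

theorem tendsto_dil (z : ℂ) : Tendsto (fun r : ℝ => dil r z) (𝓝[<] 1) (𝓝 z) := by
  have h : Continuous fun r : ℝ => dil r z := by unfold dil; fun_prop
  have := h.tendsto 1
  rw [show dil 1 z = z by simp [dil]] at this
  exact this.mono_left nhdsWithin_le_nhds

theorem eventually_Ioo {c : ℝ} (hc : c < 1) : ∀ᶠ r in 𝓝[<] (1 : ℝ), r ∈ Set.Ioo c 1 :=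
  Ioo_mem_nhdsLT hc

theorem tendsto_lintegral_closedBall_dil {f : ℂ → ℂ} (hf : DifferentiableOn ℂ f disc) {p : ℝ}
    (hp : 1 ≤ p) {R : ℝ} (hR : R < 1) :
    Tendsto (fun r => ∫⁻ z in Metric.closedBall 0 R,
      ‖deriv (f ∘ dil r - f) z‖ₑ ^ p * weight p 0 z) (𝓝[<] (1 : ℝ)) (𝓝 0) := by
  obtain ⟨L, hL0, hL⟩ := exists_norm_deriv_le hf hR
  have hsub : Metric.closedBall (0 : ℂ) R ⊆ disc := Metric.closedBall_subset_ball hR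
  have hp0 : 0 < p := by linarith
  have hcb := (Metric.isClosed_closedBall (x := (0 : ℂ)) (ε := R)).measurableSet
  rw [← lintegral_zero (μ := volume.restrict (Metric.closedBall (0 : ℂ) R))]
  refine tendsto_lintegral_filter_of_dominated_convergence
    (fun _ => ENNReal.ofReal (2 * L) ^ p) ?_ ?_ ?_ ?_
  · refine Eventually.of_forall fun r => ?_
    have := measurable_weight p 0
    have := measurable_deriv (f ∘ dil r - f)
    fun_prop
  · filter_upwards [eventually_Ioo one_pos] with r hr
    refine (ae_restrict_iff' hcb).2 (ae_of_all _ fun z hz => ?_)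
    refine (mul_le_of_le_one_right' (weight_zero_le_one hp (hsub hz))).trans
      (ENNReal.rpow_le_rpow ?_ hp0.le)
    rw [deriv_sub_disc (differentiableOn_comp_dil hf hr) hf (hsub hz),
      deriv_comp_dil hf hr (hsub hz), ← ofReal_norm]
    refine ENNReal.ofReal_le_ofReal ((norm_sub_le _ _).trans ?_)
    have hz' : ‖z‖ ≤ R := by simpa using hz
    have h1 := hL z hz'
    have h2 := hL (dil r z) (by
      rw [norm_dil hr.1]
      exact (mul_le_of_le_one_left (norm_nonneg _) hr.2.le).trans hz')
    rw [norm_mul, Complex.norm_real, Real.norm_of_nonneg hr.1.le]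
    have h3 := mul_le_of_le_one_right (norm_nonneg (deriv f (dil r z))) hr.2.le
    linarith
  · rw [setLIntegral_const]
    exact ENNReal.mul_ne_top (ENNReal.rpow_ne_top_of_nonneg hp0.le ENNReal.ofReal_ne_top)
      measure_closedBall_lt_top.ne
  · refine (ae_restrict_iff' hcb).2 (ae_of_all _ fun z hz => ?_)
    have hzd := hsub hz
    have h1 : Tendsto (fun r : ℝ => deriv f (dil r z) * r - deriv f z) (𝓝[<] 1) (𝓝 0) := by
      have h2 := ((continuousOn_deriv hf).continuousAt (isOpen_disc.mem_nhds hzd)).tendsto.comp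
        (tendsto_dil z)
      have h3 : Tendsto (fun r : ℝ => (r : ℂ)) (𝓝[<] 1) (𝓝 ((1 : ℝ) : ℂ)) :=
        (Complex.continuous_ofReal.tendsto 1).mono_left nhdsWithin_le_nhds
      have h4 := (h2.mul h3).sub_const (deriv f z)
      simpa using h4
    have h5 : Tendsto (fun r : ℝ => ‖deriv (f ∘ dil r - f) z‖ₑ) (𝓝[<] 1) (𝓝 0) := by
      have h6 := h1.enorm
      rw [enorm_zero] at h6
      refine h6.congr' ?_
      filter_upwards [eventually_Ioo one_pos] with r hr
      rw [deriv_sub_disc (differentiableOn_comp_dil hf hr) hf hzd, deriv_comp_dil hf hr hzd]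
    have h7 := ENNReal.Tendsto.mul_const (b := weight p 0 z)
      ((ENNReal.continuous_rpow_const (y := p)).tendsto 0 |>.comp h5)
      (Or.inr ENNReal.ofReal_ne_top)
    rw [ENNReal.zero_rpow_of_pos hp0, zero_mul] at h7
    exact h7

/-- Convergence of dilations at the origin. -/
theorem tendsto_osc_dil {f : ℂ → ℂ} (hf : DifferentiableOn ℂ f disc) {p : ℝ} (hp : 1 ≤ p)
    (hfin : osc p (fun z => ‖deriv f z‖ₑ) 0 ≠ ∞) :
    Tendsto (fun r => osc p (fun z => ‖deriv (f ∘ dil r - f) z‖ₑ) 0) (𝓝[<] (1 : ℝ)) (𝓝 0) := by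
  rw [ENNReal.tendsto_nhds_zero]
  intro ε hε
  have hw := measurable_weight p 0
  have hmf := measurable_deriv f
  set F : ℂ → ℝ≥0∞ := fun z => ‖deriv f z‖ₑ ^ p * weight p 0 z with hF
  have hFm : Measurable F := by fun_prop
  have hc : (2 : ℝ≥0∞) ^ (p - 1) * 5 ≠ ∞ :=
    ENNReal.mul_ne_top (ENNReal.rpow_ne_top_of_nonneg (by linarith) (by simp)) (by simp)
  -- The factor 5 = 4 + 1 accounts for the tail of the dilation and that of f.
  have hT := ENNReal.Tendsto.const_mul (tendsto_lintegral_ring hFm hfin) (Or.inr hc)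
  rw [mul_zero] at hT
  have hε2 : 0 < ε / 2 := ENNReal.half_pos hε.ne'
  obtain ⟨R, hRε, hR⟩ := ((ENNReal.tendsto_nhds_zero.1 hT (ε / 2) hε2).and
    (eventually_Ioo one_pos)).exists
  set R' := (1 + R) / 2 with hR'
  have hR'1 : R' < 1 := by rw [hR']; linarith [hR.2]
  have hRR' : R < R' := by rw [hR']; linarith [hR.2]
  have hR'0 : 0 < R' := hR.1.trans hRR'
  -- The condition r > R / R' makes the dilated ring beyond R' stay beyond R.
  filter_upwards [eventually_Ioo (c := 1 / 2) (by norm_num),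
    eventually_Ioo (c := R / R') ((div_lt_one hR'0).2 hRR'),
    ENNReal.tendsto_nhds_zero.1 (tendsto_lintegral_closedBall_dil hf hp hR'1) (ε / 2) hε2]
    with r hr hrR h1
  have hr' : r ∈ Set.Ioo (0 : ℝ) 1 := ⟨by linarith [hr.1], hr.2⟩
  have hcover : disc ⊆ Metric.closedBall 0 R' ∪ outerRing R' := fun z hz => by
    by_cases h : ‖z‖ ≤ R'
    · left; simpa using h
    · right; exact ⟨hz, not_le.1 h⟩
  have hring : ∫⁻ z in outerRing R', ‖deriv (f ∘ dil r - f) z‖ₑ ^ p * weight p 0 z ≤ ε / 2 := by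
    refine le_trans ?_ hRε
    have hmd := measurable_deriv (f ∘ dil r)
    calc ∫⁻ z in outerRing R', ‖deriv (f ∘ dil r - f) z‖ₑ ^ p * weight p 0 z
        ≤ ∫⁻ z in outerRing R', 2 ^ (p - 1) *
          (‖deriv (f ∘ dil r) z‖ₑ ^ p * weight p 0 z + F z) := by
          refine setLIntegral_mono' (measurableSet_ring R') fun z hz => ?_
          rw [deriv_sub_disc (differentiableOn_comp_dil hf hr') hf hz.1, hF, ← add_mul, ← mul_assoc]
          refine mul_le_mul' ?_ le_rfl
          exact (ENNReal.rpow_le_rpow enorm_sub_le (by linarith)).trans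
            (ENNReal.rpow_add_le_mul_rpow_add_rpow _ _ hp)
      _ = 2 ^ (p - 1) * ((∫⁻ z in outerRing R', ‖deriv (f ∘ dil r) z‖ₑ ^ p * weight p 0 z) +
          ∫⁻ z in outerRing R', F z) := by
          rw [lintegral_const_mul _ (by fun_prop), lintegral_add_left (by fun_prop)]
      _ ≤ 2 ^ (p - 1) * (4 * (∫⁻ z in outerRing R, F z) + ∫⁻ z in outerRing R, F z) := by
          refine mul_le_mul' le_rfl (add_le_add ?_ ?_)
          · refine (lintegral_ring_dil_le hf hp hr).trans
              (mul_le_mul' le_rfl (lintegral_mono_set fun z hz =>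
                ⟨hz.1, ((div_lt_iff₀ hR'0).1 hrR.1).trans hz.2⟩))
          · exact lintegral_mono_set fun z hz => ⟨hz.1, hRR'.trans hz.2⟩
      _ = _ := by ring
  calc osc p (fun z => ‖deriv (f ∘ dil r - f) z‖ₑ) 0
      ≤ ∫⁻ z in Metric.closedBall 0 R' ∪ outerRing R',
        ‖deriv (f ∘ dil r - f) z‖ₑ ^ p * weight p 0 z := lintegral_mono_set hcover
    _ ≤ _ := lintegral_union_le _ _ _
    _ ≤ ε / 2 + ε / 2 := add_le_add h1 hring
    _ = ε := ENNReal.add_halves ε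

/-- Functions in `VMOA_p` are approximated by their dilations. -/
theorem eventually_oscInt_dil_le {f : ℂ → ℂ} {p : ℝ} (hp : 1 ≤ p) (hf : f ∈ VMOA p) {ε : ℝ≥0∞}
    (hε : 0 < ε) :
    ∀ᶠ r in 𝓝[<] (1 : ℝ), ∀ a ∈ disc, oscInt p (f ∘ dil r - f) a ≤ ε := by
  have hp0 : 0 ≤ p := by linarith
  set K : ℝ≥0∞ := 2 ^ (p - 1) * (compConst p + 1) with hK
  have hKt : K ≠ ∞ := ENNReal.mul_ne_top (ENNReal.rpow_ne_top_of_nonneg (by linarith) (by simp))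
    (by simp)
  obtain ⟨ρ, hρ0, hρ1, h⟩ := tendsto_bdry_iff.1 hf.2 (ε / K) (ENNReal.div_pos hε.ne' hKt)
  set R := (1 + ρ) / 2 with hR
  have hR1 : R < 1 := by linarith
  have hρR : ρ < R := by linarith
  have hR0 : 0 < R := by linarith
  have h0 : osc p (fun z => ‖deriv f z‖ₑ) 0 ≠ ∞ := by
    intro htop
    have h1 := oscInt_zero_lt_top hp hf
    rw [oscInt_eq hp0, htop, ENNReal.mul_top (by simp)] at h1
    exact lt_irrefl _ h1
  have hlim := ENNReal.Tendsto.const_mul (a := ENNReal.ofReal (2 / (1 - R)) *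
    (ENNReal.ofReal Real.pi)⁻¹) (tendsto_osc_dil hf.1 hp h0)
    (Or.inr (ENNReal.mul_ne_top ENNReal.ofReal_ne_top (by simp [Real.pi_pos])))
  rw [mul_zero] at hlim
  filter_upwards [eventually_Ioo one_pos, eventually_Ioo (c := ρ / R) ((div_lt_one hR0).2 hρR),
    ENNReal.tendsto_nhds_zero.1 hlim ε hε] with r hr hrR h2 a ha
  -- If |a| > R, then r > ρ/R gives |ra| > ρ, so both integrals fall under the VMOA_p smallness.
  -- Otherwise convergence at the origin suffices.
  by_cases haR : R < ‖a‖
  · have hra : ρ < ‖dil r a‖ := by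
      rw [norm_dil hr.1]
      calc ρ < r * R := (div_lt_iff₀ hR0).1 hrR.1
        _ ≤ _ := by have := hr.1; gcongr
    calc oscInt p (f ∘ dil r - f) a
        ≤ 2 ^ (p - 1) * (oscInt p (f ∘ dil r) a + oscInt p f a) :=
          oscInt_sub_le hp (differentiableOn_comp_dil hf.1 hr) hf.1 a
      _ ≤ 2 ^ (p - 1) * (compConst p * (ε / K) + ε / K) := by
          refine mul_le_mul' le_rfl (add_le_add ?_ (h a ha (hρR.trans haR)))
          refine (oscInt_comp_le hf.1 (differentiable_dil r).differentiableOn (mapsTo_dil hr)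
            (injective_dil hr.1).injOn hp ha).trans (mul_le_mul' le_rfl ?_)
          exact h _ (mapsTo_dil hr ha) hra
      _ = K * (ε / K) := by rw [hK]; ring
      _ ≤ ε := ENNReal.mul_div_le
  · refine (oscInt_le_zero hp _ ha).trans (le_trans ?_ h2)
    rw [oscInt_eq hp0, mul_assoc]
    refine mul_le_mul' (ENNReal.ofReal_le_ofReal ?_) le_rfl
    push Not at haR
    have : 0 < 1 - R := by linarith
    gcongr

/-! ### Invariance of VMOA_p under univalent composition. -/

theorem lintegral_deriv_sq_le {φ : ℂ → ℂ} (hφ : DifferentiableOn ℂ φ disc)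
    (hm : Set.MapsTo φ disc disc) (hi : Set.InjOn φ disc) :
    ∫⁻ z in disc, ‖deriv φ z‖ₑ ^ 2 ≤ volume disc := by
  have h := lintegral_image_holomorphic measurableSet_disc
    (fun z hz => differentiableAt_of_disc hφ hz) hi fun _ => 1
  simp only [mul_one, lintegral_one, Measure.restrict_apply_univ] at h
  rw [← h]
  exact measure_mono hm.image_subset

theorem volume_disc_lt_top : volume disc < ∞ := measure_ball_lt_top

theorem enorm_le_ofReal {x : ℂ} {L : ℝ} (h : ‖x‖ ≤ L) : ‖x‖ₑ ≤ ENNReal.ofReal L := by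
  rw [← ofReal_norm]
  exact ENNReal.ofReal_le_ofReal h

theorem enorm_deriv_mul_le_one {φ : ℂ → ℂ} (hφ : DifferentiableOn ℂ φ disc)
    (hm : Set.MapsTo φ disc disc) {z : ℂ} (hz : z ∈ disc) :
    ‖deriv φ z‖ₑ * ENNReal.ofReal (1 - ‖z‖ ^ 2) ≤ 1 := by
  rw [← ofReal_norm, ← ENNReal.ofReal_mul (norm_nonneg _), ← ENNReal.ofReal_one]
  refine ENNReal.ofReal_le_ofReal ((norm_deriv_mul_le hφ hm hz).trans ?_)
  linarith [sq_nonneg ‖φ z‖]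

theorem tendsto_oscInt_of_tendsto_osc {p : ℝ} (hp : 0 ≤ p) {f : ℂ → ℂ} {l : Filter ℂ}
    (h : Tendsto (osc p fun z => ‖deriv f z‖ₑ) l (𝓝 0)) : Tendsto (oscInt p f) l (𝓝 0) := by
  have h1 := ENNReal.Tendsto.const_mul (a := (ENNReal.ofReal Real.pi)⁻¹) h
    (Or.inr (by simp [Real.pi_pos]))
  rw [mul_zero] at h1
  exact h1.congr fun a => (oscInt_eq hp f a).symm

/-- The derivative of g ∘ φ is at most L|φ'|. Schwarz–Pick then gives the weighted sup bound and
univalence a finite Dirichlet integral, the two hypotheses of `tendsto_osc_bdry`. -/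
theorem tendsto_oscInt_comp_of_bounded {g φ : ℂ → ℂ} (hg : DifferentiableOn ℂ g disc) {L : ℝ}
    (hL : ∀ z ∈ disc, ‖deriv g z‖ ≤ L) (hφ : DifferentiableOn ℂ φ disc)
    (hm : Set.MapsTo φ disc disc) (hi : Set.InjOn φ disc) {p : ℝ} (hp : 1 ≤ p) :
    Tendsto (oscInt p (g ∘ φ)) bdry (𝓝 0) := by
  have hd : ∀ z ∈ disc, ‖deriv (g ∘ φ) z‖ₑ ≤ ENNReal.ofReal L * ‖deriv φ z‖ₑ := fun z hz => by
    rw [deriv_comp_disc hg hφ hm hz, enorm_mul]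
    exact mul_le_mul' (enorm_le_ofReal (hL _ (hm hz))) le_rfl
  refine tendsto_oscInt_of_tendsto_osc (by linarith) (tendsto_osc_bdry hp
    (measurable_deriv _).enorm (M := ENNReal.ofReal L) (fun z hz => ?_) ENNReal.ofReal_ne_top ?_)
  · refine (mul_le_mul' (hd z hz) le_rfl).trans ?_
    rw [mul_assoc]
    exact mul_le_of_le_one_right' (enorm_deriv_mul_le_one hφ hm hz)
  · refine ne_top_of_le_ne_top (b := ENNReal.ofReal L ^ 2 * volume disc)
      (ENNReal.mul_ne_top (ENNReal.pow_ne_top ENNReal.ofReal_ne_top) volume_disc_lt_top.ne) ?_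
    calc ∫⁻ z in disc, ‖deriv (g ∘ φ) z‖ₑ ^ 2
        ≤ ∫⁻ z in disc, ENNReal.ofReal L ^ 2 * ‖deriv φ z‖ₑ ^ 2 := by
          refine setLIntegral_mono' measurableSet_disc fun z hz => ?_
          rw [← mul_pow]
          exact pow_le_pow_left₀ zero_le (hd z hz) 2
      _ = ENNReal.ofReal L ^ 2 * ∫⁻ z in disc, ‖deriv φ z‖ₑ ^ 2 :=
          lintegral_const_mul' _ _ (ENNReal.pow_ne_top ENNReal.ofReal_ne_top)
      _ ≤ _ := mul_le_mul' le_rfl (lintegral_deriv_sq_le hφ hm hi)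

/-- `VMOA_p` is invariant under composition with univalent self-maps of the disc. -/
theorem comp_mem_vmoa {f φ : ℂ → ℂ} {p : ℝ} (hp : 1 ≤ p) (hf : f ∈ VMOA p)
    (hφ : DifferentiableOn ℂ φ disc) (hm : Set.MapsTo φ disc disc) (hi : Set.InjOn φ disc) :
    f ∘ φ ∈ VMOA p := by
  refine ⟨hf.1.comp hφ hm, ENNReal.tendsto_nhds_zero.2 fun ε hε => ?_⟩
  set K : ℝ≥0∞ := 2 ^ (p - 1) * (compConst p + 1) with hK
  have hKt : K ≠ ∞ := ENNReal.mul_ne_top (ENNReal.rpow_ne_top_of_nonneg (by linarith) (by simp))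
    (by simp)
  have hε' : 0 < ε / K := ENNReal.div_pos hε.ne' hKt
  obtain ⟨r, hrε, hr⟩ := ((eventually_oscInt_dil_le hp hf hε').and (eventually_Ioo one_pos)).exists
  obtain ⟨L, -, hL⟩ := exists_norm_deriv_comp_dil_le hf.1 hr
  have hg := differentiableOn_comp_dil hf.1 hr
  filter_upwards [eventually_bdry_mem_disc, ENNReal.tendsto_nhds_zero.1
    (tendsto_oscInt_comp_of_bounded hg hL hφ hm hi hp) _ hε'] with a ha h1
  calc oscInt p (f ∘ φ) a
      ≤ 2 ^ (p - 1) * (oscInt p ((f ∘ dil r - f) ∘ φ) a + oscInt p ((f ∘ dil r) ∘ φ) a) := by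
        refine oscInt_le_of_le_add hp (fun z hz => ?_) a
        rw [show (f ∘ dil r - f) ∘ φ = (f ∘ dil r) ∘ φ - f ∘ φ from rfl,
          deriv_sub_disc (hg.comp hφ hm) (hf.1.comp hφ hm) hz, add_comm]
        refine le_trans (by rw [sub_sub_cancel]) (enorm_sub_le (a := deriv ((f ∘ dil r) ∘ φ) z))
    _ ≤ 2 ^ (p - 1) * (compConst p * (ε / K) + ε / K) := by
        refine mul_le_mul' le_rfl (add_le_add ?_ h1)
        exact (oscInt_comp_le (hg.sub hf.1) hφ hm hi hp ha).trans
          (mul_le_mul' le_rfl (hrε _ (hm ha)))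
    _ = K * (ε / K) := by rw [hK]; ring
    _ ≤ ε := ENNReal.mul_div_le

/-! ### Univalence of the members of a semigroup. -/

theorem norm_sub_le_mobius {a b : ℂ} (ha : a ∈ disc) (hb : b ∈ disc) :
    ‖a - b‖ ≤ 2 * ‖mobius a b‖ := by
  have h0 := mobius_denom_norm_pos ha hb
  have h1 : ‖1 - (starRingEnd ℂ) a * b‖ ≤ 2 := by
    refine (norm_sub_le _ _).trans ?_
    rw [norm_one, norm_mul, RCLike.norm_conj]
    have := mul_le_mul (norm_lt_one ha).le (norm_lt_one hb).le (norm_nonneg b) zero_le_one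
    linarith
  have h2 : ‖a - b‖ = ‖mobius a b‖ * ‖1 - (starRingEnd ℂ) a * b‖ := by
    rw [mobius, norm_div, div_mul_cancel₀ _ h0.ne']
  rw [h2, mul_comm]
  gcongr

namespace IsSemigroup

variable {φ : ℝ → ℂ → ℂ}

theorem tendsto_apply (h : IsSemigroup φ) {z : ℂ} (hz : z ∈ disc) :
    Tendsto (fun t => φ t z) (𝓝[>] 0) (𝓝 z) :=
  (h.tendsto {z} (by simpa using hz) isCompact_singleton).tendsto_at rfl

theorem eventually_differentiableOn (h : IsSemigroup φ) :
    ∀ᶠ t in 𝓝[>] (0 : ℝ), DifferentiableOn ℂ (φ t) disc := by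
  filter_upwards [self_mem_nhdsWithin] with t ht using h.analytic t (le_of_lt ht)

theorem tendstoLocallyUniformlyOn_deriv (h : IsSemigroup φ) :
    TendstoLocallyUniformlyOn (fun t => deriv (φ t)) (fun _ => 1) (𝓝[>] (0 : ℝ)) disc := by
  have h1 : TendstoLocallyUniformlyOn φ (fun z => z) (𝓝[>] (0 : ℝ)) disc :=
    (tendstoLocallyUniformlyOn_iff_forall_isCompact isOpen_disc).2 fun K hK hKc => h.tendsto K hK hKc
  have h2 := h1.deriv h.eventually_differentiableOn isOpen_disc
  have e : deriv (fun z : ℂ => z) = fun _ => 1 := by ext z; simp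
  rw [e] at h2
  exact h2

/-- Continuity is assumed only from the right at 0. Writing φ_t = φ_s ∘ φ_(t-s), Schwarz–Pick bounds
the increment by the pseudohyperbolic distance from z to φ_(t-s)(z), which depends only on t - s;
this gives continuity from both sides. -/
theorem continuousOn_orbit (h : IsSemigroup φ) {z : ℂ} (hz : z ∈ disc) :
    ContinuousOn (fun t => φ t z) (Set.Ici 0) := by
  have key : ∀ s t, 0 ≤ s → s ≤ t → ‖φ s z - φ t z‖ ≤ 2 * ‖mobius z (φ (t - s) z)‖ := by
    intro s t hs hst
    have hts : 0 ≤ t - s := by linarith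
    have hw := h.mapsTo _ hts hz
    have e : φ t z = φ s (φ (t - s) z) := by
      rw [h.comp s (t - s) hs hts z hz, add_sub_cancel]
    rw [e]
    exact (norm_sub_le_mobius (h.mapsTo s hs hz) (h.mapsTo s hs hw)).trans
      (mul_le_mul_of_nonneg_left (norm_mobius_map_le (h.analytic s hs) (h.mapsTo s hs) hz hw)
        zero_le_two)
  have hlim : Tendsto (fun t => 2 * ‖mobius z (φ t z)‖) (𝓝[>] 0) (𝓝 0) := by
    have h1 := ((hasDerivAt_mobius hz hz).continuousAt.tendsto.comp
      (h.tendsto_apply hz)).norm.const_mul 2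
    simpa using h1
  rw [Metric.continuousOn_iff]
  intro s hs ε hε
  obtain ⟨δ, hδ, hsub⟩ := mem_nhdsGT_iff_exists_Ioo_subset.1 (hlim.eventually (gt_mem_nhds hε))
  refine ⟨δ, hδ, fun t ht hts => ?_⟩
  rw [Real.dist_eq] at hts
  rcases lt_trichotomy s t with hst | rfl | hst
  · rw [dist_comm, dist_eq_norm]
    refine (key s t hs hst.le).trans_lt (hsub ⟨by linarith, ?_⟩)
    rwa [abs_of_pos (by linarith)] at hts
  · simpa using hε
  · rw [dist_eq_norm]
    refine (key t s ht hst.le).trans_lt (hsub ⟨by linarith, ?_⟩)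
    rwa [abs_of_neg (by linarith), neg_sub] at hts

/-- For small t, |φ_t' - 1| ≤ 1/2 on the ball, so φ_t - id contracts by 1/2 there by convexity. Two
points with equal images must then coincide. -/
theorem exists_injOn (h : IsSemigroup φ) {R : ℝ} (hR : R < 1) :
    ∃ δ > 0, ∀ t ∈ Set.Ioo 0 δ, Set.InjOn (φ t) (Metric.closedBall 0 R) := by
  have hsub : Metric.closedBall (0 : ℂ) R ⊆ disc := Metric.closedBall_subset_ball hR
  have h1 := (tendstoLocallyUniformlyOn_iff_forall_isCompact isOpen_disc).1
    h.tendstoLocallyUniformlyOn_deriv _ hsub (isCompact_closedBall 0 R)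
  have h2 := Metric.tendstoUniformlyOn_iff.1 h1 (1 / 2) (by norm_num)
  obtain ⟨δ, hδ, hd⟩ := mem_nhdsGT_iff_exists_Ioo_subset.1 h2
  refine ⟨δ, hδ, fun t ht z hz w hw hzw => ?_⟩
  have h3 := hd ht
  have hda : ∀ x ∈ Metric.closedBall (0 : ℂ) R, HasDerivAt (fun x => φ t x - x)
      (deriv (φ t) x - 1) x := fun x hx =>
    (differentiableAt_of_disc (h.analytic t ht.1.le) (hsub hx)).hasDerivAt.sub (hasDerivAt_id x)
  have h4 := (convex_closedBall (0 : ℂ) R).norm_image_sub_le_of_norm_hasDerivWithin_le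
    (C := 1 / 2) (fun x hx => (hda x hx).hasDerivWithinAt)
    (fun x hx => by
      have := h3 x hx
      rw [dist_comm, dist_eq_norm] at this
      exact this.le) hz hw
  rw [hzw, sub_sub_sub_cancel_left, norm_sub_rev] at h4
  have h5 : ‖w - z‖ = 0 := by linarith [norm_nonneg (w - z)]
  exact (sub_eq_zero.1 (norm_eq_zero.1 h5)).symm

/-- The elements of a semigroup of analytic self-maps of the disc are univalent. -/
theorem injOn (h : IsSemigroup φ) {t : ℝ} (ht : 0 ≤ t) : Set.InjOn (φ t) disc := by
  intro z hz w hw hzw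
  -- Both orbits up to time t stay in one compact ball, where small times are injective.
  have hbd : ∀ x ∈ disc, ∃ R < 1, ∀ s ∈ Set.Icc 0 t, ‖φ s x‖ ≤ R := by
    intro x hx
    have hc : ContinuousOn (fun s => ‖φ s x‖) (Set.Icc 0 t) :=
      ((h.continuousOn_orbit hx).mono Set.Icc_subset_Ici_self).norm
    obtain ⟨s, hs, hmax⟩ := isCompact_Icc.exists_isMaxOn ⟨0, le_rfl, ht⟩ hc
    exact ⟨‖φ s x‖, norm_lt_one (h.mapsTo s hs.1 hx), fun s' hs' => hmax hs'⟩
  obtain ⟨R₁, hR₁, hz'⟩ := hbd z hz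
  obtain ⟨R₂, hR₂, hw'⟩ := hbd w hw
  obtain ⟨δ, hδ, hinj⟩ := h.exists_injOn (max_lt hR₁ hR₂)
  obtain ⟨n, hn⟩ := exists_nat_gt (t / δ)
  rcases ht.eq_or_lt with rfl | htpos
  · rwa [h.zero z hz, h.zero w hw] at hzw
  have hn0 : (0 : ℝ) < n := (div_pos htpos hδ).trans hn
  set e := t / n with he
  have he0 : 0 < e := div_pos htpos hn0
  have heδ : e < δ := by
    rw [he, div_lt_iff₀ hn0]
    rwa [div_lt_iff₀ hδ, mul_comm] at hn
  -- With t = n·e and e < δ, the outermost map φ_e is cancelled one step at a time.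
  have key : ∀ k : ℕ, k ≤ n → φ (k * e) z = φ (k * e) w → z = w := by
    intro k
    induction k with
    | zero =>
      intro _ h0
      rw [Nat.cast_zero, zero_mul, h.zero z hz, h.zero w hw] at h0
      exact h0
    | succ k ih =>
      intro hk hk'
      refine ih (by omega) ?_
      have hk0 : 0 ≤ k * e := by positivity
      have hkt : k * e ≤ t := by
        have : (k : ℝ) ≤ n := by exact_mod_cast (by omega : k ≤ n)
        calc k * e ≤ n * e := by gcongr
          _ = t := by rw [he]; field_simp
      have e1 : ((k + 1 : ℕ) : ℝ) * e = e + k * e := by push_cast; ring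
      rw [e1, ← h.comp e (k * e) he0.le hk0 z hz, ← h.comp e (k * e) he0.le hk0 w hw] at hk'
      refine hinj e ⟨he0, heδ⟩ ?_ ?_ hk'
      · rw [mem_closedBall_zero_iff]
        exact (hz' _ ⟨hk0, hkt⟩).trans (le_max_left _ _)
      · rw [mem_closedBall_zero_iff]
        exact (hw' _ ⟨hk0, hkt⟩).trans (le_max_right _ _)
  refine key n le_rfl ?_
  have : (n : ℝ) * e = t := by rw [he]; field_simp
  rw [this]
  exact hzw

end IsSemigroup

/-! ### Mean square convergence and strong continuity. -/

theorem enorm_sq_eq (x : ℂ) : ‖x‖ₑ ^ 2 = ENNReal.ofReal (‖x‖ ^ 2) := by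
  rw [← ofReal_norm, ENNReal.ofReal_pow (norm_nonneg _)]

theorem enorm_add_sq_le (x y : ℂ) : ‖x + y‖ₑ ^ 2 ≤ 2 * ‖x‖ₑ ^ 2 + 2 * ‖y‖ₑ ^ 2 := by
  rw [enorm_sq_eq, enorm_sq_eq, enorm_sq_eq, show (2 : ℝ≥0∞) = ENNReal.ofReal 2 by simp,
    ← ENNReal.ofReal_mul zero_le_two, ← ENNReal.ofReal_mul zero_le_two,
    ← ENNReal.ofReal_add (by positivity) (by positivity)]
  refine ENNReal.ofReal_le_ofReal ?_
  have := norm_add_le x y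
  nlinarith [norm_nonneg (x + y), sq_nonneg (‖x‖ - ‖y‖)]

theorem enorm_parallelogram (x : ℂ) :
    ‖x - 1‖ₑ ^ 2 + ‖1 + x‖ₑ ^ 2 = 2 * ‖x‖ₑ ^ 2 + 2 := by
  rw [enorm_sq_eq, enorm_sq_eq, enorm_sq_eq, show (2 : ℝ≥0∞) = ENNReal.ofReal 2 by simp,
    ← ENNReal.ofReal_mul zero_le_two, ← ENNReal.ofReal_add (by positivity) (by positivity),
    ← ENNReal.ofReal_add (by positivity) (by positivity)]
  congr 1
  simp only [Complex.sq_norm, Complex.normSq_apply, Complex.sub_re, Complex.sub_im, Complex.add_re,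
    Complex.add_im, Complex.one_re, Complex.one_im]
  ring

/-- A univalent self-map of the disc whose derivative at the origin is close to `1` has derivative
close to `1` in mean square. -/
theorem lintegral_deriv_sub_one_sq_le {φ : ℂ → ℂ} (hφ : DifferentiableOn ℂ φ disc)
    (hm : Set.MapsTo φ disc disc) (hi : Set.InjOn φ disc) :
    ∫⁻ z in disc, ‖deriv φ z - 1‖ₑ ^ 2 ≤
      4 * volume disc - ‖1 + deriv φ 0‖ₑ ^ 2 * volume disc := by
  have hmd := measurable_deriv φ
  have hdd := hφ.deriv isOpen_disc
  -- The sub-mean value property bounds the mean of |1 + φ'|² from below, and univalence bounds that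
  -- of |φ'|² from above. The parallelogram law converts these into an upper bound for |φ' - 1|².
  have hsub : ‖1 + deriv φ 0‖ₑ ^ 2 * volume disc ≤ ∫⁻ z in disc, ‖1 + deriv φ z‖ₑ ^ 2 := by
    have := enorm_rpow_mul_volume_le (G := fun z => 1 + deriv φ z) (w := 0) one_pos one_le_two
      (hdd.const_add 1)
    simpa only [ENNReal.rpow_two] using this
  refine ENNReal.le_sub_of_add_le_right
    (ENNReal.mul_ne_top (ENNReal.pow_ne_top enorm_ne_top) volume_disc_lt_top.ne) ?_
  calc (∫⁻ z in disc, ‖deriv φ z - 1‖ₑ ^ 2) + ‖1 + deriv φ 0‖ₑ ^ 2 * volume disc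
      ≤ (∫⁻ z in disc, ‖deriv φ z - 1‖ₑ ^ 2) + ∫⁻ z in disc, ‖1 + deriv φ z‖ₑ ^ 2 := by
        gcongr
    _ = ∫⁻ z in disc, (2 * ‖deriv φ z‖ₑ ^ 2 + 2) := by
        rw [← lintegral_add_left (by fun_prop)]
        exact lintegral_congr fun z => enorm_parallelogram _
    _ = 2 * (∫⁻ z in disc, ‖deriv φ z‖ₑ ^ 2) + 2 * volume disc := by
        rw [lintegral_add_left (by fun_prop), lintegral_const_mul' _ _ (by simp),
          setLIntegral_const]
    _ ≤ 2 * volume disc + 2 * volume disc := by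
        gcongr
        exact lintegral_deriv_sq_le hφ hm hi
    _ = 4 * volume disc := by ring

namespace IsSemigroup

variable {φ : ℝ → ℂ → ℂ}

theorem eventually_pos : ∀ᶠ t in 𝓝[>] (0 : ℝ), 0 ≤ t := by
  filter_upwards [self_mem_nhdsWithin] with t ht using le_of_lt ht

/-- As φ_t'(0) tends to 1, the bound 4V - |1 + φ_t'(0)|² V tends to 0, where V is the area of the
disc. -/
theorem tendsto_lintegral_deriv_sub_one (h : IsSemigroup φ) :
    Tendsto (fun t => ∫⁻ z in disc, ‖deriv (φ t) z - 1‖ₑ ^ 2) (𝓝[>] (0 : ℝ)) (𝓝 0) := by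
  have h1 : Tendsto (fun t => deriv (φ t) 0) (𝓝[>] (0 : ℝ)) (𝓝 1) :=
    h.tendstoLocallyUniformlyOn_deriv.tendsto_at zero_mem_disc
  have h2 := ENNReal.Tendsto.mul_const (b := volume disc)
    (ENNReal.Tendsto.pow (n := 2) (h1.const_add 1).enorm) (Or.inr volume_disc_lt_top.ne)
  have h3 := ENNReal.Tendsto.sub (tendsto_const_nhds (x := 4 * volume disc)) h2
    (Or.inl (ENNReal.mul_ne_top (by simp) volume_disc_lt_top.ne))
  have e : ‖(1 + 1 : ℂ)‖ₑ ^ 2 = 4 := by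
    rw [enorm_sq_eq, one_add_one_eq_two, Complex.norm_ofNat]; norm_num
  rw [e, tsub_self] at h3
  refine tendsto_of_tendsto_of_tendsto_of_le_of_le' tendsto_const_nhds h3
    (Eventually.of_forall fun _ => zero_le) ?_
  filter_upwards [eventually_pos] with t ht
  exact lintegral_deriv_sub_one_sq_le (h.analytic t ht) (h.mapsTo t ht) (h.injOn ht)

theorem tendsto_dirichlet (h : IsSemigroup φ) {g : ℂ → ℂ} (hg : DifferentiableOn ℂ g disc) {L : ℝ}
    (hL : ∀ z ∈ disc, ‖deriv g z‖ ≤ L) :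
    Tendsto (fun t => ∫⁻ z in disc, ‖deriv (g ∘ φ t - g) z‖ₑ ^ 2) (𝓝[>] (0 : ℝ)) (𝓝 0) := by
  have hlim : Tendsto (fun t => ∫⁻ z in disc, ‖deriv g (φ t z) - deriv g z‖ₑ ^ 2)
      (𝓝[>] (0 : ℝ)) (𝓝 (∫⁻ _ in disc, 0)) := by
    -- Nothing is known about φ_t outside the disc; the indicator supplies global measurability.
    have hind : ∀ t, ∫⁻ z in disc, ‖deriv g (φ t z) - deriv g z‖ₑ ^ 2 =
        ∫⁻ z in disc, disc.indicator (fun z => ‖deriv g (φ t z) - deriv g z‖ₑ ^ 2) z := fun t =>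
      setLIntegral_congr_fun measurableSet_disc fun z hz => by
        rw [Set.indicator_of_mem hz]
    simp only [hind]
    refine tendsto_lintegral_filter_of_dominated_convergence
      (fun _ => ENNReal.ofReal (2 * L) ^ 2) ?_ ?_ ?_ ?_
    · filter_upwards [eventually_pos] with t ht
      have h1 : ContinuousOn (fun z => deriv g (φ t z)) disc :=
        (continuousOn_deriv hg).comp (h.analytic t ht).continuousOn (h.mapsTo t ht)
      exact measurable_indicator_of_continuousOn
        ((ENNReal.continuous_pow 2).comp_continuousOn (h1.sub (continuousOn_deriv hg)).enorm)
        measurableSet_disc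
    · filter_upwards [eventually_pos] with t ht
      refine (ae_restrict_iff' measurableSet_disc).2 (ae_of_all _ fun z hz => ?_)
      rw [Set.indicator_of_mem hz]
      refine pow_le_pow_left₀ zero_le (enorm_le_ofReal ((norm_sub_le _ _).trans ?_)) 2
      linarith [hL z hz, hL _ (h.mapsTo t ht hz)]
    · rw [setLIntegral_const]
      exact ENNReal.mul_ne_top (ENNReal.pow_ne_top ENNReal.ofReal_ne_top) volume_disc_lt_top.ne
    · refine (ae_restrict_iff' measurableSet_disc).2 (ae_of_all _ fun z hz => ?_)
      have h1 := ((continuousOn_deriv hg).continuousAt (isOpen_disc.mem_nhds hz)).tendsto.comp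
        (h.tendsto_apply hz)
      have h2 := ENNReal.Tendsto.pow (n := 2) (h1.sub_const (deriv g z)).enorm
      rw [sub_self, enorm_zero, zero_pow two_ne_zero] at h2
      exact h2.congr fun t => (Set.indicator_of_mem hz _).symm
  rw [lintegral_zero] at hlim
  have hA := ENNReal.Tendsto.const_mul (a := 2 * ENNReal.ofReal L ^ 2)
    h.tendsto_lintegral_deriv_sub_one (Or.inr (by finiteness))
  have hB := ENNReal.Tendsto.const_mul (a := 2) hlim (Or.inr (by simp))
  have hAB := hA.add hB
  rw [mul_zero, mul_zero, add_zero] at hAB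
  refine tendsto_of_tendsto_of_tendsto_of_le_of_le' tendsto_const_nhds hAB
    (Eventually.of_forall fun _ => zero_le) ?_
  filter_upwards [eventually_pos] with t ht
  have hd := h.analytic t ht
  have hm := h.mapsTo t ht
  have hmd := measurable_deriv (φ t)
  rw [← lintegral_const_mul' _ _ (by finiteness), ← lintegral_const_mul' _ _ (by simp),
    ← lintegral_add_left (by fun_prop)]
  refine setLIntegral_mono' measurableSet_disc fun z hz => ?_
  rw [deriv_sub_disc (hg.comp hd hm) hg hz, deriv_comp_disc hg hd hm hz]
  -- The first term is small by mean square convergence of φ_t', the second by dominated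
  -- convergence.
  have e : deriv g (φ t z) * deriv (φ t) z - deriv g z =
      deriv g (φ t z) * (deriv (φ t) z - 1) + (deriv g (φ t z) - deriv g z) := by ring
  rw [e]
  refine (enorm_add_sq_le _ _).trans (add_le_add ?_ le_rfl)
  rw [enorm_mul, mul_pow, ← mul_assoc]
  refine mul_le_mul' (mul_le_mul' le_rfl (pow_le_pow_left₀ zero_le ?_ 2)) le_rfl
  exact enorm_le_ofReal (hL _ (hm hz))

theorem eventually_oscInt_le_of_bounded (h : IsSemigroup φ) {g : ℂ → ℂ}
    (hg : DifferentiableOn ℂ g disc) {L : ℝ} (hL : ∀ z ∈ disc, ‖deriv g z‖ ≤ L) {p : ℝ}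
    (hp : 1 ≤ p) {ε : ℝ≥0∞} (hε : 0 < ε) :
    ∀ᶠ t in 𝓝[>] (0 : ℝ), ∀ a ∈ disc, oscInt p (g ∘ φ t - g) a ≤ ε := by
  have hp0 : 0 ≤ p := by linarith
  -- By Schwarz–Pick, g ∘ φ_t and g each contribute at most L to the weighted sup of the derivative,
  -- whatever t is.
  set M : ℝ≥0∞ := 2 * ENNReal.ofReal L with hM
  have hMt : M ≠ ∞ := by finiteness
  set K : ℝ≥0∞ := (ENNReal.ofReal Real.pi)⁻¹ * ((1 + M) ^ p + (1 + discConst)) with hK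
  have hKt : K ≠ ∞ := by
    refine ENNReal.mul_ne_top (by simp [Real.pi_pos]) ?_
    have := discConst_lt_top.ne
    have := ENNReal.rpow_ne_top_of_nonneg hp0 (ENNReal.add_ne_top.2 ⟨ENNReal.one_ne_top, hMt⟩)
    finiteness
  have hθ : 0 < min (p / 2) 1 := lt_min (by linarith) one_pos
  have h1 := ENNReal.Tendsto.const_mul (a := K)
    ((ENNReal.continuous_rpow_const (y := min (p / 2) 1)).tendsto 0 |>.comp
      (h.tendsto_dirichlet hg hL)) (Or.inr hKt)
  rw [ENNReal.zero_rpow_of_pos hθ, mul_zero] at h1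
  filter_upwards [ENNReal.tendsto_nhds_zero.1 h1 ε hε, eventually_pos] with t h2 ht a ha
  refine le_trans ?_ h2
  have hd := h.analytic t ht
  have hm := h.mapsTo t ht
  rw [oscInt_eq hp0, hK, mul_assoc]
  refine mul_le_mul' le_rfl ((osc_le_dirichlet hp (measurable_deriv _).enorm (M := M)
    (fun z hz => ?_) hMt ha).trans (mul_le_mul' le_rfl (ENNReal.rpow_le_rpow ?_ hθ.le)))
  · rw [deriv_sub_disc (hg.comp hd hm) hg hz, deriv_comp_disc hg hd hm hz]
    refine (mul_le_mul' (enorm_sub_le (b := deriv g z)) le_rfl).trans ?_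
    rw [add_mul, enorm_mul, mul_assoc, hM, two_mul]
    refine add_le_add ((mul_le_of_le_one_right' (enorm_deriv_mul_le_one hd hm hz)).trans
      (enorm_le_ofReal (hL _ (hm hz)))) ?_
    refine (mul_le_of_le_one_right' ?_).trans (enorm_le_ofReal (hL _ hz))
    rw [← ENNReal.ofReal_one]
    exact ENNReal.ofReal_le_ofReal (by linarith [sq_nonneg ‖z‖])
  · refine lintegral_mono fun z => mul_le_of_le_one_right' ?_
    exact ENNReal.rpow_le_one (mobWeight_le_one a z) (by positivity)

/-- With g a dilation of f, f ∘ φ_t - f splits into (f - g) ∘ φ_t, g ∘ φ_t - g and g - f. The first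
is small uniformly in t, since the composition constant does not depend on φ_t. -/
theorem eventually_oscInt_le (h : IsSemigroup φ) {f : ℂ → ℂ} {p : ℝ} (hp : 1 ≤ p)
    (hf : f ∈ VMOA p) {ε : ℝ≥0∞} (hε : 0 < ε) :
    ∀ᶠ t in 𝓝[>] (0 : ℝ), ∀ a ∈ disc, oscInt p (f ∘ φ t - f) a ≤ ε := by
  set K : ℝ≥0∞ := 2 ^ (p - 1) * (compConst p + 2 ^ (p - 1) * 2) with hK
  have hKt : K ≠ ∞ := by
    have : (2 : ℝ≥0∞) ^ (p - 1) ≠ ∞ := ENNReal.rpow_ne_top_of_nonneg (by linarith) (by simp)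
    finiteness
  have hε' : 0 < ε / K := ENNReal.div_pos hε.ne' hKt
  obtain ⟨r, hrε, hr⟩ := ((eventually_oscInt_dil_le hp hf hε').and (eventually_Ioo one_pos)).exists
  obtain ⟨L, -, hL⟩ := exists_norm_deriv_comp_dil_le hf.1 hr
  have hg := differentiableOn_comp_dil hf.1 hr
  set g := f ∘ dil r
  filter_upwards [h.eventually_oscInt_le_of_bounded hg hL hp hε', eventually_pos] with t h1 ht a ha
  have hd := h.analytic t ht
  have hm := h.mapsTo t ht
  have hfφ := hf.1.comp hd hm
  have hgφ := hg.comp hd hm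
  calc oscInt p (f ∘ φ t - f) a
      ≤ 2 ^ (p - 1) * (oscInt p ((g - f) ∘ φ t) a + oscInt p (g ∘ φ t - f) a) := by
        refine oscInt_le_of_le_add hp (fun z hz => ?_) a
        rw [show (g - f) ∘ φ t = g ∘ φ t - f ∘ φ t from rfl, deriv_sub_disc hgφ hfφ hz,
          deriv_sub_disc hfφ hf.1 hz, deriv_sub_disc hgφ hf.1 hz, add_comm]
        refine le_trans (le_of_eq ?_) (enorm_sub_le (b := deriv (g ∘ φ t) z - deriv (f ∘ φ t) z))
        congr 1
        ring
    _ ≤ 2 ^ (p - 1) * (oscInt p ((g - f) ∘ φ t) a +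
          2 ^ (p - 1) * (oscInt p (g ∘ φ t - g) a + oscInt p (g - f) a)) := by
        refine mul_le_mul' le_rfl (add_le_add le_rfl (oscInt_le_of_le_add hp (fun z hz => ?_) a))
        rw [deriv_sub_disc hgφ hf.1 hz, deriv_sub_disc hgφ hg hz, deriv_sub_disc hg hf.1 hz]
        exact le_trans (by rw [sub_add_sub_cancel]) (enorm_add_le _ _)
    _ ≤ 2 ^ (p - 1) * (compConst p * (ε / K) + 2 ^ (p - 1) * (ε / K + ε / K)) := by
        refine mul_le_mul' le_rfl (add_le_add ?_ (mul_le_mul' le_rfl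
          (add_le_add (h1 a ha) (hrε a ha))))
        exact (oscInt_comp_le (hg.sub hf.1) hd hm (h.injOn ht) hp ha).trans
          (mul_le_mul' le_rfl (hrε _ (hm ha)))
    _ = K * (ε / K) := by rw [hK]; ring
    _ ≤ ε := ENNReal.mul_div_le

theorem tendsto_bmoaNorm (h : IsSemigroup φ) {f : ℂ → ℂ} {p : ℝ} (hp : 1 ≤ p)
    (hf : f ∈ VMOA p) :
    Tendsto (fun t => bmoaNorm p (f ∘ φ t - f)) (𝓝[>] (0 : ℝ)) (𝓝 0) := by
  have hp0 : 0 < p := by linarith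
  have h1 : Tendsto (fun t => ⨆ a ∈ disc, oscInt p (f ∘ φ t - f) a) (𝓝[>] (0 : ℝ)) (𝓝 0) := by
    rw [ENNReal.tendsto_nhds_zero]
    intro ε hε
    filter_upwards [h.eventually_oscInt_le hp hf hε] with t ht
    exact iSup₂_le ht
  have h2 : Tendsto (fun t => ENNReal.ofReal (‖(f ∘ φ t - f) 0‖ ^ p)) (𝓝[>] (0 : ℝ)) (𝓝 0) := by
    have h3 := ((differentiableAt_of_disc hf.1 zero_mem_disc).continuousAt.tendsto.comp
      (h.tendsto_apply zero_mem_disc)).sub_const (f 0)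
    have h4 := ENNReal.tendsto_ofReal (h3.norm.rpow_const (p := p) (Or.inr hp0.le))
    simpa [Real.zero_rpow hp0.ne'] using h4
  have h12 := h2.add h1
  rw [add_zero] at h12
  have h5 := (ENNReal.continuous_rpow_const (y := 1 / p)).tendsto 0 |>.comp h12
  rw [ENNReal.zero_rpow_of_pos (by positivity)] at h5
  exact h5

end IsSemigroup

/-! ### Point evaluations and the operator norm. -/

theorem exists_enorm_deriv_rpow_le {p : ℝ} (hp : 1 ≤ p) {R : ℝ} (hR : R < 1) :
    ∃ B : ℝ≥0, ∀ f : ℂ → ℂ, DifferentiableOn ℂ f disc → ∀ z, ‖z‖ ≤ R →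
      ‖deriv f z‖ₑ ^ p ≤ B * oscInt p f 0 := by
  -- Whitney discs centred in |z| ≤ R stay at distance at least d from the unit circle, so the
  -- weight is bounded below on them.
  set d := (1 - R) / 2 with hd
  have hd0 : 0 < d := by linarith
  set B := Real.pi * (9 / (Real.pi * d ^ 2) / d ^ (p - 1)) with hB
  refine ⟨B.toNNReal, fun f hf z hz => ?_⟩
  have hzd : z ∈ disc := by rw [mem_ball_zero_iff]; linarith
  refine (enorm_rpow_le_whitney (hf.deriv isOpen_disc) hp hzd).trans ?_
  change _ ≤ ENNReal.ofReal B * _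
  rw [oscInt_eq (by linarith), hB, ENNReal.ofReal_mul Real.pi_pos.le, mul_mul_mul_comm,
    ENNReal.mul_inv_cancel (by simp [Real.pi_pos]) ENNReal.ofReal_ne_top, one_mul, osc,
    ← lintegral_const_mul' _ _ ENNReal.ofReal_ne_top]
  refine le_trans (setLIntegral_mono' measurableSet_ball fun ζ hζ => ?_)
    (lintegral_mono_set ball_whitney_subset)
  have hζd := ball_whitney_subset hζ
  rw [mem_ball_iff_norm] at hζ
  have h1 : d ≤ 1 - ‖ζ‖ := by
    have := (dist_bounds hζ).1
    rw [hd]; linarith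
  have h2 : d ≤ 1 - ‖ζ‖ ^ 2 := by
    have := norm_lt_one hζd
    nlinarith [norm_nonneg ζ]
  rw [mul_left_comm, weight_zero hζd, ← ENNReal.ofReal_mul (by positivity)]
  refine mul_le_mul' le_rfl (ENNReal.ofReal_le_ofReal ?_)
  rw [div_mul_eq_mul_div, le_div_iff₀ (by positivity)]
  have : 0 ≤ p - 1 := by linarith
  gcongr

/-- The derivative bound and the mean value inequality on |z| ≤ |c| carry f(0) to f(c). Membership
in VMOA_p makes the integral at the origin finite, hence the bound usable as a real Lipschitz
constant. This handles the term |f(φ(0))|^p in the norm of f ∘ φ. -/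
theorem exists_enorm_apply_rpow_le {p : ℝ} (hp : 1 ≤ p) {c : ℂ} (hc : c ∈ disc) :
    ∃ K : ℝ≥0, ∀ f ∈ VMOA p, ‖f c‖ₑ ^ p ≤ K * (‖f 0‖ₑ ^ p + oscInt p f 0) := by
  have hp0 : 0 < p := by linarith
  have hc1 := norm_lt_one hc
  obtain ⟨B, hB⟩ := exists_enorm_deriv_rpow_le hp hc1
  refine ⟨2 ^ (p - 1) * (1 + B), fun f hf => ?_⟩
  set Q : ℝ≥0∞ := B * oscInt p f 0 with hQ
  have hQt : Q ≠ ∞ := ENNReal.mul_ne_top ENNReal.coe_ne_top (oscInt_zero_lt_top hp hf).ne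
  have hQt' : Q ^ (1 / p) ≠ ∞ := ENNReal.rpow_ne_top_of_nonneg (by positivity) hQt
  have hder : ∀ z ∈ Metric.closedBall (0 : ℂ) ‖c‖, ‖deriv f z‖ ≤ (Q ^ (1 / p)).toReal := by
    intro z hz
    have h1 := hB f hf.1 z (by simpa using hz)
    rw [← toReal_enorm]
    refine ENNReal.toReal_mono hQt' ?_
    rw [one_div, ENNReal.le_rpow_inv_iff hp0]
    exact h1
  have hsub : Metric.closedBall (0 : ℂ) ‖c‖ ⊆ disc := Metric.closedBall_subset_ball hc1
  have h2 := (convex_closedBall (0 : ℂ) ‖c‖).norm_image_sub_le_of_norm_deriv_le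
    (fun z hz => differentiableAt_of_disc hf.1 (hsub hz)) hder (x := 0) (y := c)
    (by simp) (by simp)
  have h3 : ‖f c - f 0‖ₑ ≤ Q ^ (1 / p) := by
    rw [← ENNReal.ofReal_toReal hQt']
    refine enorm_le_ofReal (h2.trans ?_)
    rw [sub_zero]
    exact mul_le_of_le_one_right ENNReal.toReal_nonneg hc1.le
  calc ‖f c‖ₑ ^ p ≤ (‖f 0‖ₑ + Q ^ (1 / p)) ^ p := by
        refine ENNReal.rpow_le_rpow ?_ hp0.le
        calc ‖f c‖ₑ = ‖f 0 + (f c - f 0)‖ₑ := by rw [add_sub_cancel]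
          _ ≤ _ := (enorm_add_le _ _).trans (add_le_add le_rfl h3)
    _ ≤ 2 ^ (p - 1) * (‖f 0‖ₑ ^ p + (Q ^ (1 / p)) ^ p) :=
        ENNReal.rpow_add_le_mul_rpow_add_rpow _ _ hp
    _ = 2 ^ (p - 1) * (‖f 0‖ₑ ^ p + B * oscInt p f 0) := by
        rw [← ENNReal.rpow_mul, one_div_mul_cancel hp0.ne', ENNReal.rpow_one]
    _ ≤ 2 ^ (p - 1) * ((1 + B) * ‖f 0‖ₑ ^ p + (1 + B) * oscInt p f 0) := by
        refine mul_le_mul' le_rfl (add_le_add ?_ (mul_le_mul' le_add_self le_rfl))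
        exact (one_mul (‖f 0‖ₑ ^ p)).symm.le.trans (mul_le_mul' le_self_add le_rfl)
    _ = _ := by
        rw [ENNReal.coe_mul, ENNReal.coe_rpow_of_nonneg _ (by linarith)]
        push_cast
        ring

/-- Boundedness on `VMOA_p` of composition with a univalent self-map of the disc. -/
theorem exists_bmoaNorm_comp_le {φ : ℂ → ℂ} (hφ : DifferentiableOn ℂ φ disc)
    (hm : Set.MapsTo φ disc disc) (hi : Set.InjOn φ disc) {p : ℝ} (hp : 1 ≤ p) :
    ∃ C : ℝ≥0, ∀ f ∈ VMOA p, bmoaNorm p (f ∘ φ) ≤ C * bmoaNorm p f := by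
  have hp0 : 0 < p := by linarith
  obtain ⟨K, hK⟩ := exists_enorm_apply_rpow_le hp (hm zero_mem_disc)
  refine ⟨(K + compConst p) ^ (1 / p), fun f hf => ?_⟩
  rw [ENNReal.coe_rpow_of_nonneg _ (by positivity), bmoaNorm, bmoaNorm,
    ← ENNReal.mul_rpow_of_nonneg _ _ (by positivity)]
  refine ENNReal.rpow_le_rpow ?_ (by positivity)
  rw [← enorm_rpow _ hp0.le, ← enorm_rpow _ hp0.le]
  set S := ⨆ a ∈ disc, oscInt p f a with hS
  have hle : ∀ a ∈ disc, oscInt p f a ≤ S := fun a ha => le_iSup₂ (f := fun a _ => oscInt p f a) a ha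
  have h1 : ‖(f ∘ φ) 0‖ₑ ^ p ≤ K * (‖f 0‖ₑ ^ p + S) :=
    (hK f hf).trans (mul_le_mul' le_rfl (add_le_add le_rfl (hle 0 zero_mem_disc)))
  have h2 : ⨆ a ∈ disc, oscInt p (f ∘ φ) a ≤ compConst p * (‖f 0‖ₑ ^ p + S) := by
    refine iSup₂_le fun a ha => (oscInt_comp_le hf.1 hφ hm hi hp ha).trans (mul_le_mul' le_rfl ?_)
    exact (hle _ (hm ha)).trans le_add_self
  calc _ ≤ K * (‖f 0‖ₑ ^ p + S) + compConst p * (‖f 0‖ₑ ^ p + S) := add_le_add h1 h2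
    _ = _ := by push_cast; ring

end

end BMOAp

theorem mainTheorem7 (φ : ℝ → ℂ → ℂ) (hφ : BMOAp.IsSemigroup φ) (p : ℝ) (hp : 1 ≤ p) :
    BMOAp.IsStronglyContinuousOn φ (BMOAp.VMOA p) (BMOAp.bmoaNorm p) ∧
      BMOAp.VMOA p ⊆ BMOAp.maximalSubspace φ (BMOAp.BMOA p) (BMOAp.bmoaNorm p) := by
  refine ⟨⟨fun t ht f hf => ?_, fun t ht => ?_, fun f _ z hz => ?_, fun t s ht hs f _ z hz => ?_,
    fun f hf => hφ.tendsto_bmoaNorm hp hf⟩, fun f hf => ?_⟩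
  · exact BMOAp.comp_mem_vmoa hp hf (hφ.analytic t ht) (hφ.mapsTo t ht) (hφ.injOn ht)
  · exact BMOAp.exists_bmoaNorm_comp_le (hφ.analytic t ht) (hφ.mapsTo t ht) (hφ.injOn ht) hp
  · simp only [Function.comp, hφ.zero z hz]
  · simp only [Function.comp, hφ.comp t s ht hs z hz]
  · exact ⟨BMOAp.vmoa_subset_bmoa hp hf, hφ.tendsto_bmoaNorm hp hf⟩
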